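/- **Setup.** Let $X$ be a complex manifold, let $\mathcal F \subseteq T_X$ be a subsheaf of $\mathbb C_X$-modules (i.e. stable under multiplication by locally constant functions) of the sheaf of holomorphic vector fields that is closed under the Lie bracket, and let $f : Y \hookrightarrow X$ be the inclusion of a reduced (locally closed) complex subspace. Let $\mathcal F_Y \subseteq f^*T_X$ be the image of $f^{-1}\mathcal F \to f^*T_X$, and let $\mathcal G \subseteq \mathcal F_Y$ be an obstruction sheaf for $\mathcal F$: a subsheaf of abelian groups such that, for every open $U \subseteq X$ and all $A_1, A_2 \in \mathcal F(U)$ with $f^*A_1 = f^*A_2$, one has $f^*[A_1,A_2] \in \mathcal G(U\cap Y)$. A *time-dependent vector field in $\mathcal F$* is a vector field on $X\times\mathbb C$ of the form $A = \sum_{i=0}^N t^i A_i$ (some $N$) with $A_i \in H^0(X,\mathcal F)$, where $t$ is the coordinate on $\mathbb C$; $A_t$ denotes its restriction to time $t$. Put $D(A) := \frac{\partial}{\partial t} + A$. For $n \ge 1$, such an $A$ is *$n$-admissible for $\mathcal G$* if $\bigl(\mathcal L_{D(A)}^m A\bigr)_0\big|_Y \in H^0(Y,\mathcal G)$ for all $1\le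 m\le n$, where $\mathcal L_{D(A)}$ is the Lie derivative on $X\times\mathbb C$. An $n$-th order jet at $x\in X$ is a morphism $\operatorname{Spec}\mathbb C[t]/(t^{n+1}) \to X$ mapping the closed point to $x$, i.e. a $\mathbb C$-algebra homomorphism $\mathcal O_{X,x}\to\mathbb C[t]/(t^{n+1})$. Let $\tau^n_A(x)$ denote the $n$-th order jet at $x$ of the holomorphic curve germ $\gamma$ with $\gamma(0)=x$ and $\gamma'(t) = A_t(\gamma(t))$. If two $(n+1)$-st order jets $\sigma,\tau$ at $x$ have the same $n$-th order part, their difference $\sigma-\tau\in T_X|_x$ is the difference of their derivatives of order $n+1$: it is the tangent vector $v$ with $\sigma(g)-\tau(g) = dg(v)\,\frac{t^{n+1}}{(n+1)!}$ for all $g \in \mathcal O_{X,x}$. **Proposition 3.2 (Extension of jets from $n$-th to $(n+1)$-st order).** Let $n\ge 1$, let $A$ be an $n$-admissible vector field for $\mathcal G$, and let $\Delta\in H^0(X,\mathcal F)$ be a time-independent vector field with $\Delta|_Y\in H^0(Y,\mathcal G)$. Then there exists a time-dependent vector field $B$ such that 1. $B$ is $(n+1)$-admissible for $\mathcal G$;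 2. the $n$-th order jets induced by $A$ and $B$ agree on $Y$: $\tau^n_A|_Y = \tau^n_B|_Y$; 3. the difference between the induced $(n+1)$-st order jets is given by $\Delta$: $\tau^{n+1}_B|_Y - \tau^{n+1}_A|_Y = \Delta|_Y$. -/

import Mathlib

open scoped Manifold ContDiff Topology
open TopologicalSpace

noncomputable section

namespace JetExt

/-! ### Vector fields and subsheaves of the tangent sheaf

`X` is a complex manifold modelled on the finite-dimensional complex vector space `E`. -/

section Sheaves

variable (E : Type*) [NormedAddCommGroup E] [NormedSpace ℂ E]
  (X : Type*) [TopologicalSpace X] [ChartedSpace E X]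

/-- (Not necessarily holomorphic) vector fields on `X`. A section of the tangent sheaf over an
open set `U` is represented by a function on all of `X` of which only the values on `U` matter. -/
abbrev VField : Type _ := (x : X) → TangentSpace 𝓘(ℂ, E) x

variable {E X} [IsManifold 𝓘(ℂ, E) ω X]

/-- The vector field `V` is holomorphic on the set `U`. -/
def HolomorphicOn (V : VField E X) (U : Set X) : Prop :=
  ContMDiffOn 𝓘(ℂ, E) 𝓘(ℂ, E).tangent ω (fun x => (⟨x, V x⟩ : TangentBundle 𝓘(ℂ, E) X)) U

variable (E X)

/-- A subsheaf of `ℂ_X`-modules of the sheaf `T_X` of holomorphic vector fields: for every open `U`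
a complex vector space of holomorphic vector fields on `U` (closed under changing the irrelevant
values outside `U`), stable under restriction, and such that a vector field which locally on `U`
is a section is a section over `U`. -/
structure TangentSubsheaf where
  /-- The sections over an open set. -/
  sections : Opens X → Submodule ℂ (VField E X)
  holomorphic : ∀ U, ∀ V ∈ sections U, HolomorphicOn V U
  congr : ∀ U, ∀ V ∈ sections U, ∀ W : VField E X, (∀ x ∈ U, W x = V x) → W ∈ sections U
  restrict : ∀ U U' : Opens X, U' ≤ U → ∀ V ∈ sections U, V ∈ sections U'
  glue : ∀ (U : Opens X) (V : VField E X),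
    (∀ x ∈ U, ∃ U' : Opens X, x ∈ U' ∧ U' ≤ U ∧ V ∈ sections U') → V ∈ sections U

variable {E X}

/-- The subsheaf `F` of `T_X` is closed under the Lie bracket. -/
def TangentSubsheaf.LieClosed (F : TangentSubsheaf E X) : Prop :=
  ∀ U : Opens X, ∀ V ∈ F.sections U, ∀ W ∈ F.sections U,
    VectorField.mlieBracket 𝓘(ℂ, E) V W ∈ F.sections U

variable (E)

/-- `Y` is the underlying set of a reduced complex subspace of `X`: near each of its points, `Y`
is the common zero set of finitely many holomorphic functions. -/
def IsReducedSubspace (Y : Set X) : Prop :=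
  ∀ y ∈ Y, ∃ (U : Opens X) (k : ℕ) (f : Fin k → X → ℂ), y ∈ U ∧
    (∀ i, ContMDiffOn 𝓘(ℂ, E) 𝓘(ℂ, ℂ) ω (f i) U) ∧
    ∀ x ∈ U, x ∈ Y ↔ ∀ i, f i x = 0

/-- Vector fields along `Y`, i.e. set-theoretic sections of the pull-back to `Y` of the tangent
bundle of `X`. As `Y` is reduced, a section of `f^* T_X` is determined by its values. Again,
sections over an open subset of `Y` are represented by functions on `Y`. -/
abbrev VFieldAlong (Y : Set X) : Type _ := (y : Y) → TangentSpace 𝓘(ℂ, E) (y : X)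

variable {E}

/-- The restriction to `Y` of a vector field on `X`. -/
def restrictTo (Y : Set X) (V : VField E X) : VFieldAlong E Y := fun y => V y

/-- The open subset `U ∩ Y` of `Y`. -/
def preimageOpens (Y : Set X) (U : Opens X) : Opens Y :=
  ⟨Subtype.val ⁻¹' (U : Set X), U.isOpen.preimage continuous_subtype_val⟩

/-- Membership in `F_Y(V)`, where `F_Y` is the image sheaf of `f⁻¹ F → f^* T_X`: near each point
of `V`, the field `s` along `Y` is the restriction to `Y` of a section of `F`. -/
def TangentSubsheaf.IsLocallyInduced (F : TangentSubsheaf E X) (Y : Set X) (V : Opens Y)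
    (s : VFieldAlong E Y) : Prop :=
  ∀ y ∈ V, ∃ U : Opens X, (y : X) ∈ U ∧ ∃ A ∈ F.sections U,
    ∀ z ∈ V, (z : X) ∈ U → s z = A z

/-- A subsheaf (of abelian groups) `G` of `F_Y`. -/
structure AlongSubsheaf (F : TangentSubsheaf E X) (Y : Set X) where
  /-- The sections over an open subset of `Y`. -/
  sections : Opens Y → AddSubgroup (VFieldAlong E Y)
  locallyInduced : ∀ V, ∀ s ∈ sections V, F.IsLocallyInduced Y V s
  congr : ∀ V, ∀ s ∈ sections V, ∀ s' : VFieldAlong E Y, (∀ y ∈ V, s' y = s y) → s' ∈ sections V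
  restrict : ∀ V V' : Opens Y, V' ≤ V → ∀ s ∈ sections V, s ∈ sections V'
  glue : ∀ (V : Opens Y) (s : VFieldAlong E Y),
    (∀ y ∈ V, ∃ V' : Opens Y, y ∈ V' ∧ V' ≤ V ∧ s ∈ sections V') → s ∈ sections V

/-- `G` is an obstruction sheaf for `F`: for all sections `A₁, A₂` of `F` over an open set `U`
which agree along `Y`, the restriction to `Y` of their Lie bracket is a section of `G`. -/
def IsObstructionSheaf {F : TangentSubsheaf E X} {Y : Set X} (G : AlongSubsheaf F Y) : Prop :=
  ∀ U : Opens X, ∀ A₁ ∈ F.sections U, ∀ A₂ ∈ F.sections U,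
    (∀ x ∈ U, x ∈ Y → A₁ x = A₂ x) →
    restrictTo Y (VectorField.mlieBracket 𝓘(ℂ, E) A₁ A₂) ∈ G.sections (preimageOpens Y U)

end Sheaves

/-! ### Time-dependent vector fields and admissibility -/

section TimeDependent

variable (E : Type*) [NormedAddCommGroup E] [NormedSpace ℂ E]
  (X : Type*) [TopologicalSpace X] [ChartedSpace E X]

/-- Vector fields on `X × ℂ`. The tangent space at `(x, t)` is `T_x X × ℂ`. -/
abbrev ProdVField : Type _ := (p : X × ℂ) → TangentSpace (𝓘(ℂ, E).prod 𝓘(ℂ, ℂ)) p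

variable {E X}

/-- The value in `T_x X` at time `t` of the component along `X` of a vector field on `X × ℂ`. -/
def ProdVField.atTime (A : ProdVField E X) (t : ℂ) : VField E X := fun x => (A (x, t)).1

variable (E X) in
/-- The vector field `∂/∂t` on `X × ℂ`. -/
def ddt : ProdVField E X := fun _ => ((0 : E), (1 : ℂ))

/-- The vector field `D(A) = ∂/∂t + A` with constant flow in time. -/
def constFlow (A : ProdVField E X) : ProdVField E X := ddt E X + A

/-- The Lie derivative `L_{D(A)}` on vector fields on `X × ℂ`. -/
def lieD (A V : ProdVField E X) : ProdVField E X :=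
  VectorField.mlieBracket (𝓘(ℂ, E).prod 𝓘(ℂ, ℂ)) (constFlow A) V

variable [IsManifold 𝓘(ℂ, E) ω X]

/-- `A` is a time-dependent vector field in `F`: a finite sum `∑ tⁱ Aᵢ` with `Aᵢ` in `H⁰(X, F)`,
considered as a vector field on `X × ℂ` without component in the direction of `ℂ`. -/
def IsTimeDependentIn (F : TangentSubsheaf E X) (A : ProdVField E X) : Prop :=
  ∃ (N : ℕ) (a : ℕ → VField E X), (∀ i, a i ∈ F.sections ⊤) ∧
    ∀ (x : X) (t : ℂ), A (x, t) = (∑ i ∈ Finset.range (N + 1), t ^ i • a i x, (0 : ℂ))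

/-- `A` is `n`-admissible for `G`: it is a time-dependent vector field in `F`, and
`(L_{D(A)}^m A)_0|_Y` lies in `H⁰(Y, G)` for all `1 ≤ m ≤ n`. -/
def IsAdmissible {F : TangentSubsheaf E X} {Y : Set X} (G : AlongSubsheaf F Y) (n : ℕ)
    (A : ProdVField E X) : Prop :=
  IsTimeDependentIn F A ∧
    ∀ m : ℕ, 1 ≤ m → m ≤ n → restrictTo Y (ProdVField.atTime ((lieD A)^[m] A) 0) ∈ G.sections ⊤

end TimeDependent

/-! ### Jets -/

section Jets

variable (E : Type*) [NormedAddCommGroup E] [NormedSpace ℂ E]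
  {X : Type*} [TopologicalSpace X] [ChartedSpace E X]

/-- The algebra of functions on `X` that are holomorphic near `x`. -/
def holoAt (x : X) : Subalgebra ℂ (X → ℂ) where
  carrier := {f | ContMDiffAt 𝓘(ℂ, E) 𝓘(ℂ, ℂ) ω f x}
  mul_mem' hf hg := ContMDiffAt.mul hf hg
  add_mem' hf hg := ContMDiffAt.add hf hg
  algebraMap_mem' _ := contMDiffAt_const

/-- The ideal of functions vanishing near `x`. -/
def germZero (x : X) : Ideal (holoAt E x) where
  carrier := {f | ∀ᶠ z in 𝓝 x, (f : X → ℂ) z = 0}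
  zero_mem' := by simp
  add_mem' hf hg := by
    filter_upwards [hf, hg] with z h₁ h₂
    simp [h₁, h₂]
  smul_mem' c f hf := by
    filter_upwards [hf] with z h
    simp [h]

/-- The local ring `𝒪_{X,x}` of germs of holomorphic functions. -/
abbrev Stalk (x : X) : Type _ := holoAt E x ⧸ germZero E x

/-- The germ at `x` of a function that is holomorphic near `x`. -/
def germ {x : X} (f : X → ℂ) (hf : ContMDiffAt 𝓘(ℂ, E) 𝓘(ℂ, ℂ) ω f x) : Stalk E x :=
  Ideal.Quotient.mk (germZero E x) ⟨f, hf⟩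

/-- The algebra `ℂ[t]/(t^{n+1})`. -/
abbrev TruncPoly (n : ℕ) : Type :=
  Polynomial ℂ ⧸ Ideal.span {(Polynomial.X : Polynomial ℂ) ^ (n + 1)}

/-- The projection `ℂ[t]/(t^{n+2}) → ℂ[t]/(t^{n+1})`. -/
def TruncPoly.proj (n : ℕ) : TruncPoly (n + 1) →ₐ[ℂ] TruncPoly n :=
  Ideal.Quotient.factorₐ ℂ (Ideal.span_singleton_le_span_singleton.2 (pow_dvd_pow _ (by lia)))

/-- An `n`-th order jet at `x`, i.e. a morphism from `Spec ℂ[t]/(t^{n+1})` to `X` that maps the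
closed point to `x`, i.e. a homomorphism of `ℂ`-algebras `𝒪_{X,x} → ℂ[t]/(t^{n+1})`. -/
abbrev Jet (n : ℕ) (x : X) : Type _ := Stalk E x →ₐ[ℂ] TruncPoly n

variable {E}

/-- The forgetful map from `(n+1)`-st to `n`-th order jets. -/
def Jet.proj {n : ℕ} {x : X} (σ : Jet E (n + 1) x) : Jet E n x := (TruncPoly.proj n).comp σ

/-- `σ - τ = v` in the sense of the affine bundle structure of the space of `(n+1)`-st order jets
over the space of `n`-th order jets: the `n`-th order parts of the `(n+1)`-st order jets `σ, τ`
agree, and the tangent vector `v` is the difference between their derivatives of order `n + 1`,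
i.e. `σ(f) - τ(f) = df(v) t^{n+1} / (n+1)!` for every holomorphic function germ `f` at `x`. -/
def Jet.HasDifference {n : ℕ} {x : X} (σ τ : Jet E (n + 1) x) (v : TangentSpace 𝓘(ℂ, E) x) :
    Prop :=
  σ.proj = τ.proj ∧
  ∀ (f : X → ℂ) (hf : ContMDiffAt 𝓘(ℂ, E) 𝓘(ℂ, ℂ) ω f x),
    letI df : TangentSpace 𝓘(ℂ, E) x → ℂ := fun w => mfderiv 𝓘(ℂ, E) 𝓘(ℂ, ℂ) f x w
    σ (germ E f hf) - τ (germ E f hf) =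
      Ideal.Quotient.mk _ (Polynomial.C (df v / (n + 1).factorial) * Polynomial.X ^ (n + 1))

/-- The `n`-th order Taylor polynomial at `0` of a function of one variable. -/
def taylorPoly (n : ℕ) (g : ℂ → ℂ) : Polynomial ℂ :=
  ∑ k ∈ Finset.range (n + 1), Polynomial.monomial k (iteratedDeriv k g 0 / k.factorial)

lemma taylorPoly_coeff (n : ℕ) (g : ℂ → ℂ) (k : ℕ) (hk : k < n + 1) :
    (taylorPoly n g).coeff k = iteratedDeriv k g 0 / k.factorial := by
  simp only [taylorPoly, Polynomial.finsetSum_coeff, Polynomial.coeff_monomial]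
  rw [Finset.sum_ite_eq' (Finset.range (n + 1)) k]
  simp [hk]

lemma mk_eq_mk_of_coeff {n : ℕ} {p q : Polynomial ℂ} (h : ∀ k < n + 1, p.coeff k = q.coeff k) :
    (Ideal.Quotient.mk _ p : TruncPoly n) = Ideal.Quotient.mk _ q := by
  rw [Ideal.Quotient.eq, Ideal.mem_span_singleton, Polynomial.X_pow_dvd_iff]
  intro k hk
  rw [Polynomial.coeff_sub, h k hk, sub_self]

lemma contDiffAt_comp_curve {x : X} {γ : ℂ → X} (h0 : γ 0 = x)
    (hγ : ContMDiffAt 𝓘(ℂ, ℂ) 𝓘(ℂ, E) ω γ 0) (f : holoAt E x) (k : ℕ) :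
    ContDiffAt ℂ k ((f : X → ℂ) ∘ γ) 0 := by
  subst h0
  have h := ContMDiffAt.comp (0 : ℂ) f.2 hγ
  exact (contMDiffAt_iff_contDiffAt.1 h).of_le le_top

/-- The `n`-th order jet at `x` associated with the germ at `0` of a holomorphic curve `γ` with
`γ(0) = x`: the homomorphism that sends the germ of `f` to the Taylor polynomial of `f ∘ γ`. -/
def curveJet (n : ℕ) {x : X} (γ : ℂ → X) (h0 : γ 0 = x)
    (hγ : ContMDiffAt 𝓘(ℂ, ℂ) 𝓘(ℂ, E) ω γ 0) : Jet E n x :=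
  Ideal.Quotient.liftₐ (germZero E x)
    { toFun := fun f => Ideal.Quotient.mk _ (taylorPoly n ((f : X → ℂ) ∘ γ))
      map_one' := by
        rw [← map_one (Ideal.Quotient.mk _)]
        refine mk_eq_mk_of_coeff fun k hk => ?_
        rw [taylorPoly_coeff n _ k hk]
        have : (((1 : holoAt E x) : X → ℂ) ∘ γ) = fun _ => (1 : ℂ) := rfl
        rw [this, iteratedDeriv_const, Polynomial.coeff_one]
        split_ifs <;> simp_all
      map_mul' := fun f g => by
        rw [← map_mul]
        refine mk_eq_mk_of_coeff fun k hk => ?_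
        rw [taylorPoly_coeff n _ k hk, Polynomial.coeff_mul]
        have : (((f * g : holoAt E x) : X → ℂ) ∘ γ)
          = ((f : X → ℂ) ∘ γ) * ((g : X → ℂ) ∘ γ) := rfl
        rw [this, iteratedDeriv_mul (contDiffAt_comp_curve h0 hγ f k)
          (contDiffAt_comp_curve h0 hγ g k), Finset.Nat.sum_antidiagonal_eq_sum_range_succ_mk,
          Finset.sum_div]
        refine Finset.sum_congr rfl fun i hi => ?_
        have hi' : i ≤ k := Nat.lt_succ_iff.1 (Finset.mem_range.1 hi)
        rw [taylorPoly_coeff n _ i (by lia), taylorPoly_coeff n _ (k - i) (by lia),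
          Nat.cast_choose ℂ hi']
        have h1 : (k.factorial : ℂ) ≠ 0 := Nat.cast_ne_zero.2 k.factorial_ne_zero
        have h2 : (i.factorial : ℂ) ≠ 0 := Nat.cast_ne_zero.2 i.factorial_ne_zero
        have h3 : ((k - i).factorial : ℂ) ≠ 0 := Nat.cast_ne_zero.2 (k - i).factorial_ne_zero
        field_simp
      map_zero' := by
        rw [← map_zero (Ideal.Quotient.mk _)]
        refine mk_eq_mk_of_coeff fun k hk => ?_
        rw [taylorPoly_coeff n _ k hk]
        have : (((0 : holoAt E x) : X → ℂ) ∘ γ) = fun _ => (0 : ℂ) := rfl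
        rw [this, iteratedDeriv_const]
        simp
      map_add' := fun f g => by
        rw [← map_add]
        refine mk_eq_mk_of_coeff fun k hk => ?_
        rw [Polynomial.coeff_add, taylorPoly_coeff n _ k hk, taylorPoly_coeff n _ k hk,
          taylorPoly_coeff n _ k hk]
        have : (((f + g : holoAt E x) : X → ℂ) ∘ γ)
          = ((f : X → ℂ) ∘ γ) + ((g : X → ℂ) ∘ γ) := rfl
        rw [this, iteratedDeriv_add (contDiffAt_comp_curve h0 hγ f k)
          (contDiffAt_comp_curve h0 hγ g k), add_div]
      commutes' := fun c => by
        change _ = Ideal.Quotient.mk _ (Polynomial.C c)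
        refine mk_eq_mk_of_coeff fun k hk => ?_
        rw [taylorPoly_coeff n _ k hk]
        have : (((algebraMap ℂ (holoAt E x) c : holoAt E x) : X → ℂ) ∘ γ) = fun _ => c := rfl
        rw [this, iteratedDeriv_const, Polynomial.coeff_C]
        split_ifs <;> simp_all }
    (fun f hf => by
      change Ideal.Quotient.mk _ _ = _
      rw [← map_zero (Ideal.Quotient.mk _)]
      refine mk_eq_mk_of_coeff fun k hk => ?_
      have h : ((f : X → ℂ) ∘ γ) =ᶠ[𝓝 0] fun _ => (0 : ℂ) := by
        have hc : Filter.Tendsto γ (𝓝 0) (𝓝 x) := h0 ▸ hγ.continuousAt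
        exact hc.eventually hf
      rw [taylorPoly_coeff n _ k hk, h.iteratedDeriv_eq, iteratedDeriv_const]
      simp)

/-- The germ at `0` of the holomorphic curve `γ` is the integral curve of the time-dependent
vector field `A` through `x`: `γ(0) = x` and `γ'(t) = A_t(γ(t))` for all `t` near `0`. -/
structure IsIntegralCurveGerm (A : ProdVField E X) (x : X) (γ : ℂ → X) : Prop where
  initial : γ 0 = x
  holomorphic : ContMDiffAt 𝓘(ℂ, ℂ) 𝓘(ℂ, E) ω γ 0
  deriv : ∀ᶠ t in 𝓝 (0 : ℂ), HasMFDerivAt 𝓘(ℂ, ℂ) 𝓘(ℂ, E) γ t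
    ((1 : ℂ →L[ℂ] ℂ).smulRight (A.atTime t (γ t)))

open Classical in
/-- The integral curve of `A` through `x`. For a holomorphic time-dependent vector field it exists
and its germ at `0` is unique; the constant curve is a placeholder in the case where `A` is not
holomorphic and has no integral curve. -/
def integralCurve (A : ProdVField E X) (x : X) : ℂ → X :=
  if h : ∃ γ, IsIntegralCurveGerm A x γ then h.choose else fun _ => x

lemma integralCurve_zero (A : ProdVField E X) (x : X) : integralCurve A x 0 = x := by
  unfold integralCurve
  split_ifs with h
  · exact h.choose_spec.initial
  · rfl

lemma contMDiffAt_integralCurve (A : ProdVField E X) (x : X) :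
    ContMDiffAt 𝓘(ℂ, ℂ) 𝓘(ℂ, E) ω (integralCurve A x) 0 := by
  unfold integralCurve
  split_ifs with h
  · exact h.choose_spec.holomorphic
  · exact contMDiffAt_const

/-- The value at `x` of the section `τ^n_A` of the `n`-th jet bundle: the `n`-th order jet
associated with the integral curve of `A` through `x`. -/
def inducedJet (n : ℕ) (A : ProdVField E X) (x : X) : Jet E n x :=
  curveJet n (integralCurve A x) (integralCurve_zero A x) (contMDiffAt_integralCurve A x)

end Jets

end JetExt

/-! ### Holomorphic ordinary differential equations: existence, and response to a small
perturbation. -/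

section HolomorphicODE

open Metric Filter Asymptotics

variable {E : Type*} [NormedAddCommGroup E] [NormedSpace ℂ E]

/-! Write `A = ∑ tⁱ aᵢ` and change it only in degrees `n` and `n + 1`: `B = A + tⁿ/n! · Δ + tⁿ⁺¹ W`.

Jets: a perturbation `tⁿ/n! · Δ` of the velocity integrates to a displacement `tⁿ⁺¹/(n+1)! · Δ +
o(tⁿ⁺¹)` of the integral curve, and `W` is felt only in order `n + 2`. The two claims about jets
therefore hold for every holomorphic `W` (`isLittleO_sub_of_hasDerivAt_perturbation`,
`iteratedDeriv_comp_isIntegralCurveGerm`).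

Admissibility: in terms of coefficients in `t`, the Lie derivative along `D(A)` sends `v` to `(k+1)
v_{k+1} + ∑_{i+j=k} [aᵢ, vⱼ]` in degree `k` (`lieD_polyField`). Only `∂/∂t` lowers the degree. So if
two fields first differ in degree `p`, the discrepancy of their iterated Lie derivatives moves down
one degree at each step and reaches time zero after `p` steps, multiplied by `p!`
(`iterate_coeffLieD_sub`). With `p = n`, the conditions for `m < n` are untouched and the one for `m
= n` changes by `Δ`, which is in `G`. With `p = n + 1`, the term `W` adds `(n+1)! W` to the last
iterate at time zero, so `W` can be chosen to make it vanish; closedness of `F` under brackets keeps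
`W` in `F`. -/

lemma norm_sub_le_of_hasDerivAt_ball {g g' : ℂ → E} {r C : ℝ}
    (hg : ∀ t ∈ ball (0 : ℂ) r, HasDerivAt g (g' t) t)
    (hC : ∀ t ∈ ball (0 : ℂ) r, ‖g' t‖ ≤ C) {t : ℂ} (ht : t ∈ ball (0 : ℂ) r) :
    ‖g t - g 0‖ ≤ C * ‖t‖ := by
  have h0 : (0 : ℂ) ∈ ball (0 : ℂ) r :=
    mem_ball_self ((norm_nonneg t).trans_lt (mem_ball_zero_iff.1 ht))
  simpa using (convex_ball (0 : ℂ) r).norm_image_sub_le_of_norm_hasDerivWithin_le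
    (fun s hs => (hg s hs).hasDerivWithinAt) hC h0 ht

/-- **Picard–Lindelöf theorem** in the complex domain: a holomorphic time-dependent ordinary
differential equation has a holomorphic local solution. -/
theorem exists_eventually_hasDerivAt_of_contDiffAt [CompleteSpace E] {f : ℂ × E → E} {x₀ : E}
    (hf : ContDiffAt ℂ 1 f (0, x₀)) :
    ∃ γ : ℂ → E, γ 0 = x₀ ∧ ∀ᶠ t in 𝓝 (0 : ℂ), HasDerivAt γ (f (t, γ t)) t := by
  obtain ⟨K, s, hs, hK⟩ := hf.exists_lipschitzOnWith
  have hd : ∀ᶠ p in 𝓝 ((0 : ℂ), x₀), DifferentiableAt ℂ f p :=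
    (hf.eventually (by simp)).mono fun p hp => hp.differentiableAt (by simp)
  have hb : ∀ᶠ p in 𝓝 ((0 : ℂ), x₀), ‖f p‖ < ‖f (0, x₀)‖ + 1 :=
    hf.continuousAt.norm.eventually_lt_const (by linarith)
  obtain ⟨R, hR, hball⟩ := Metric.eventually_nhds_iff_ball.1 ((hd.and hb).and hs)
  set M := ‖f (0, x₀)‖ + 1 with hM
  have hM0 : 0 < M := by positivity
  -- `M * r ≤ R / 2` keeps the Picard iterates in the ball where `f` is controlled; `K * r ≤ 1 / 2`
  -- makes the iteration contract.
  obtain ⟨r, hr, hrR, hrM, hrK⟩ : ∃ r : ℝ, 0 < r ∧ r ≤ R ∧ M * r ≤ R / 2 ∧ K * r ≤ 1 / 2 := by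
    refine ⟨min R (min (R / 2 / M) (1 / 2 / (K + 1))), ?_, min_le_left _ _, ?_, ?_⟩
    · positivity
    · calc M * _ ≤ M * (R / 2 / M) :=
          mul_le_mul_of_nonneg_left ((min_le_right _ _).trans (min_le_left _ _)) hM0.le
        _ = R / 2 := by field_simp
    · calc (K : ℝ) * _ ≤ (K + 1) * (1 / 2 / (K + 1)) := by
            refine mul_le_mul (by linarith) ((min_le_right _ _).trans (min_le_right _ _))
              ?_ (by positivity)
            positivity
        _ = 1 / 2 := by field_simp
  have hmem : ∀ t ∈ ball (0 : ℂ) r, ∀ e ∈ closedBall x₀ (R / 2),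
      (t, e) ∈ ball ((0 : ℂ), x₀) R := fun t ht e he => by
    rw [← ball_prod_same]
    exact ⟨ball_subset_ball hrR ht, closedBall_subset_ball (by linarith) he⟩
  let S := {g : ℂ → E // DifferentiableOn ℂ g (ball 0 r) ∧
    ∀ t ∈ ball (0 : ℂ) r, g t ∈ closedBall x₀ (R / 2)}
  -- The Picard operator takes a primitive of `t ↦ f (t, g t)`, which exists because a holomorphic
  -- function on a disc is exact. No path integral is needed.
  have step : ∀ g : S, ∃ G : S, G.1 0 = x₀ ∧
      ∀ t ∈ ball (0 : ℂ) r, HasDerivAt G.1 (f (t, g.1 t)) t := fun ⟨g, hg, hg'⟩ => by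
    have hd : DifferentiableOn ℂ (fun t => f (t, g t)) (ball 0 r) := fun t ht =>
      ((hball _ (hmem t ht _ (hg' t ht))).1.1.comp_differentiableWithinAt t
        (differentiableWithinAt_id.prodMk (hg t ht)))
    obtain ⟨G, hG0, hG⟩ := hd.isExactOn_ball.with_val_at 0 x₀
    refine ⟨⟨G, fun t ht => (hG t ht).differentiableAt.differentiableWithinAt,
      fun t ht => ?_⟩, hG0, hG⟩
    rw [mem_closedBall, dist_eq_norm, ← hG0]
    calc ‖G t - G 0‖ ≤ M * ‖t‖ := norm_sub_le_of_hasDerivAt_ball hG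
          (fun t ht => (hball _ (hmem t ht _ (hg' t ht))).1.2.le) ht
      _ ≤ M * r := mul_le_mul_of_nonneg_left (mem_ball_zero_iff.1 ht).le hM0.le
      _ ≤ R / 2 := hrM
  choose P hP0 hP using step
  let g₀ : S := ⟨fun _ => x₀, differentiableOn_const _,
    fun _ _ => mem_closedBall_self (by linarith)⟩
  let u : ℕ → S := fun k => P^[k] g₀
  have hu : ∀ k, u (k + 1) = P (u k) := fun k => Function.iterate_succ_apply' P k g₀
  have hu0 : ∀ k, (u k).1 0 = x₀ := fun k => by
    cases k with
    | zero => rfl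
    | succ k => rw [hu]; exact hP0 _
  have hdist : ∀ t ∈ ball (0 : ℂ) r, ∀ k, dist ((u k).1 t) ((u (k + 1)).1 t)
      ≤ R / 2 * (1 / 2) ^ k := by
    intro t ht k
    induction k generalizing t with
    | zero =>
      rw [pow_zero, mul_one, dist_comm]
      exact (u 1).2.2 t ht
    | succ k ih =>
      have hder : ∀ t ∈ ball (0 : ℂ) r, HasDerivAt
          (fun t => (u (k + 1)).1 t - (u (k + 1 + 1)).1 t)
          (f (t, (u k).1 t) - f (t, (u (k + 1)).1 t)) t := fun t ht => by
        rw [hu (k + 1)]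
        nth_rewrite 1 [hu k]
        exact (hP _ t ht).sub (hP _ t ht)
      have hle : ∀ t ∈ ball (0 : ℂ) r, ‖f (t, (u k).1 t) - f (t, (u (k + 1)).1 t)‖
          ≤ K * (R / 2 * (1 / 2) ^ k) := fun t ht => by
        rw [← dist_eq_norm]
        refine (hK.dist_le_mul _ (hball _ (hmem t ht _ ((u k).2.2 t ht))).2 _
          (hball _ (hmem t ht _ ((u (k + 1)).2.2 t ht))).2).trans ?_
        refine mul_le_mul_of_nonneg_left ?_ K.2
        rw [Prod.dist_eq]
        simpa using ih t ht
      have := norm_sub_le_of_hasDerivAt_ball hder hle ht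
      simp only [hu0, sub_self, sub_zero] at this
      rw [dist_eq_norm]
      calc _ ≤ _ := this
        _ ≤ K * (R / 2 * (1 / 2) ^ k) * r :=
          mul_le_mul_of_nonneg_left (mem_ball_zero_iff.1 ht).le (by positivity)
        _ = (K * r) * (R / 2 * (1 / 2) ^ k) := by ring
        _ ≤ 1 / 2 * (R / 2 * (1 / 2) ^ k) := mul_le_mul_of_nonneg_right hrK (by positivity)
        _ = _ := by ring
  -- The membership hypothesis sits inside the existential so that `choose` yields a function on all
  -- of `ℂ`; its values off the disc are irrelevant.
  have hlim : ∀ t, ∃ l, t ∈ ball (0 : ℂ) r → Tendsto (fun k => (u k).1 t) atTop (𝓝 l) := by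
    intro t
    by_cases ht : t ∈ ball (0 : ℂ) r
    · obtain ⟨l, hl⟩ := cauchySeq_tendsto_of_complete
        (cauchySeq_of_le_geometric (1 / 2) (R / 2) (by norm_num) (hdist t ht))
      exact ⟨l, fun _ => hl⟩
    · exact ⟨0, fun h => absurd h ht⟩
  choose γ hγ using hlim
  have hunif : TendstoUniformlyOn (fun k => (u k).1) γ atTop (ball 0 r) := by
    rw [Metric.tendstoUniformlyOn_iff]
    intro ε hε
    have hz : Tendsto (fun k : ℕ => R / 2 * (1 / 2 : ℝ) ^ k / (1 - 1 / 2)) atTop (𝓝 0) := by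
      simpa using ((tendsto_pow_atTop_nhds_zero_of_lt_one (r := (1 / 2 : ℝ)) (by norm_num)
        (by norm_num)).const_mul (R / 2)).div_const (1 - 1 / 2 : ℝ)
    filter_upwards [hz.eventually_lt_const hε] with k hk t ht
    rw [dist_comm]
    exact (dist_le_of_le_geometric_of_tendsto (1 / 2) (R / 2) (by norm_num) (hdist t ht)
      (hγ t ht) k).trans_lt hk
  have hloc := hunif.tendstoLocallyUniformlyOn
  have hγd : DifferentiableOn ℂ γ (ball 0 r) :=
    hloc.differentiableOn (.of_forall fun k => (u k).2.1) isOpen_ball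
  have h0 : (0 : ℂ) ∈ ball (0 : ℂ) r := mem_ball_self hr
  refine ⟨γ, tendsto_nhds_unique (hγ 0 h0) (by simp [hu0]), ?_⟩
  filter_upwards [isOpen_ball.mem_nhds h0] with t ht
  -- Locally uniform limits of holomorphic functions commute with differentiation, so the equation
  -- passes to the limit directly.
  have h1 := (hloc.deriv (.of_forall fun k => (u k).2.1) isOpen_ball).tendsto_at ht
  have hγm : γ t ∈ closedBall x₀ (R / 2) :=
    isClosed_closedBall.mem_of_tendsto (hγ t ht) (.of_forall fun k => (u k).2.2 t ht)
  have h2 : Tendsto (fun k => f (t, (u k).1 t)) atTop (𝓝 (f (t, γ t))) :=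
    (hball _ (hmem t ht _ hγm)).1.1.continuousAt.tendsto.comp
      (tendsto_const_nhds.prodMk_nhds (hγ t ht))
  have h3 : deriv γ t = f (t, γ t) := by
    refine tendsto_nhds_unique (h1.comp (tendsto_add_atTop_nat 1)) (h2.congr fun k => ?_)
    simp only [Function.comp_apply, hu]
    exact (hP _ t ht).deriv.symm
  exact h3 ▸ (hγd.differentiableAt (isOpen_ball.mem_nhds ht)).hasDerivAt

/-- Mean value inequality on the disc of radius `‖t‖`. Keeping the constant `c` gives both the `O`
and the `o` version. -/
lemma isBigOWith_pow_succ_of_hasDerivAt {z z' : ℂ → E} {k : ℕ} {c : ℝ} (hc : 0 ≤ c) (hz0 : z 0 = 0)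
    (hz : ∀ᶠ t in 𝓝 (0 : ℂ), HasDerivAt z (z' t) t)
    (h : IsBigOWith c (𝓝 0) z' fun t => t ^ k) :
    IsBigOWith c (𝓝 0) z fun t => t ^ (k + 1) := by
  obtain ⟨r, hr, hball⟩ := Metric.eventually_nhds_iff_ball.1 (hz.and h.bound)
  refine IsBigOWith.of_bound ?_
  filter_upwards [ball_mem_nhds (0 : ℂ) hr] with t ht
  have hsub : closedBall (0 : ℂ) ‖t‖ ⊆ ball 0 r :=
    closedBall_subset_ball (mem_ball_zero_iff.1 ht)
  have := (convex_closedBall (0 : ℂ) ‖t‖).norm_image_sub_le_of_norm_hasDerivWithin_le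
    (C := c * ‖t‖ ^ k)
    (fun s hs => (hball s (hsub hs)).1.hasDerivWithinAt)
    (fun s hs => (hball s (hsub hs)).2.trans (by
      rw [norm_pow]
      exact mul_le_mul_of_nonneg_left
        (pow_le_pow_left₀ (norm_nonneg _) (mem_closedBall_zero_iff.1 hs) _) hc))
    (mem_closedBall_self (norm_nonneg t)) (mem_closedBall_zero_iff.2 le_rfl)
  simpa [hz0, pow_succ, mul_assoc] using this

lemma isBigO_pow_succ_of_hasDerivAt {z z' : ℂ → E} {k : ℕ} (hz0 : z 0 = 0)
    (hz : ∀ᶠ t in 𝓝 (0 : ℂ), HasDerivAt z (z' t) t) (h : z' =O[𝓝 0] fun t => t ^ k) :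
    z =O[𝓝 0] fun t => t ^ (k + 1) := by
  obtain ⟨c, hc, h⟩ := h.exists_nonneg
  exact (isBigOWith_pow_succ_of_hasDerivAt hc hz0 hz h).isBigO

lemma isLittleO_pow_succ_of_hasDerivAt {z z' : ℂ → E} {k : ℕ} (hz0 : z 0 = 0)
    (hz : ∀ᶠ t in 𝓝 (0 : ℂ), HasDerivAt z (z' t) t) (h : z' =o[𝓝 0] fun t => t ^ k) :
    z =o[𝓝 0] fun t => t ^ (k + 1) :=
  isLittleO_iff_forall_isBigOWith.2 fun _ hc =>
    isBigOWith_pow_succ_of_hasDerivAt hc.le hz0 hz (isLittleO_iff_forall_isBigOWith.1 h hc)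

/-- Perturbing the right hand side of an ordinary differential equation by `t ^ n • η t` changes
the solution by `t ^ (n + 1) / (n + 1) • η 0` up to terms of higher order. -/
theorem isLittleO_sub_of_hasDerivAt_perturbation {f : ℂ × E → E} {x₀ : E}
    (hf : ContDiffAt ℂ 1 f (0, x₀)) {u v η : ℂ → E} {n : ℕ} (hu0 : u 0 = x₀) (hv0 : v 0 = x₀)
    (hu : ∀ᶠ t in 𝓝 (0 : ℂ), HasDerivAt u (f (t, u t)) t)
    (hv : ∀ᶠ t in 𝓝 (0 : ℂ), HasDerivAt v (f (t, v t) + t ^ n • η t) t)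
    (hη : ContinuousAt η 0) :
    (fun t => v t - u t - (t ^ (n + 1) / (n + 1)) • η 0) =o[𝓝 0] fun t => t ^ (n + 1) := by
  obtain ⟨K, s, hs, hK⟩ := hf.exists_lipschitzOnWith
  have hcu : ContinuousAt u 0 := hu.self_of_nhds.continuousAt
  have hcv : ContinuousAt v 0 := hv.self_of_nhds.continuousAt
  have hus : ∀ᶠ t in 𝓝 (0 : ℂ), (t, u t) ∈ s :=
    (continuousAt_id.prodMk hcu).eventually_mem (by simpa [hu0] using hs)
  have hvs : ∀ᶠ t in 𝓝 (0 : ℂ), (t, v t) ∈ s :=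
    (continuousAt_id.prodMk hcv).eventually_mem (by simpa [hv0] using hs)
  have hLip : (fun t => f (t, v t) - f (t, u t)) =O[𝓝 0] fun t => v t - u t := by
    refine IsBigO.of_bound K ?_
    filter_upwards [hus, hvs] with t h1 h2
    have := hK.dist_le_mul _ h2 _ h1
    rwa [dist_eq_norm, Prod.dist_eq, dist_self, max_eq_right dist_nonneg, dist_eq_norm] at this
  have hw : ∀ᶠ t in 𝓝 (0 : ℂ), HasDerivAt (fun t => v t - u t)
      ((f (t, v t) - f (t, u t)) + t ^ n • η t) t := by
    filter_upwards [hu, hv] with t h1 h2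
    exact (h2.fun_sub h1).congr_deriv (by abel)
  have hη1 : η =O[𝓝 0] fun _ => (1 : ℂ) := hη.isBigO_one ℂ
  have hpert : (fun t : ℂ => t ^ n • η t) =O[𝓝 0] fun t => t ^ n := by
    simpa using (isBigO_refl (fun t : ℂ => t ^ n) (𝓝 0)).smul hη1
  have hpow : ∀ {i j : ℕ}, i ≤ j → (fun t : ℂ => t ^ j) =O[𝓝 0] fun t => t ^ i :=
    fun h => IsBigO.of_bound 1 (by
      filter_upwards [ball_mem_nhds (0 : ℂ) one_pos] with t ht
      rw [norm_pow, norm_pow, one_mul]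
      exact pow_le_pow_of_le_one (norm_nonneg t) (mem_ball_zero_iff.1 ht).le h)
  -- Bootstrap in place of Grönwall: the derivative of `v - u` is `O(v - u) + O(tⁿ)`, so each
  -- integration gains one power of `t`, up to `n + 1`.
  have hO : ∀ j ≤ n + 1, (fun t => v t - u t) =O[𝓝 0] fun t : ℂ => t ^ j := by
    intro j
    induction j with
    | zero => intro _; simpa using (hcv.sub hcu).isBigO_one ℂ
    | succ j ih =>
      intro hj
      exact isBigO_pow_succ_of_hasDerivAt (by simp [hu0, hv0]) hw
        ((hLip.trans (ih (by lia))).add (hpert.trans (hpow (by lia))))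
  have hn : ((n : ℂ) + 1) ≠ 0 := Nat.cast_add_one_ne_zero n
  -- Once the main term is subtracted, the derivative is `O(tⁿ⁺¹) + tⁿ (η t - η 0)`, which is
  -- `o(tⁿ)`.
  refine isLittleO_pow_succ_of_hasDerivAt
    (z' := fun t => (f (t, v t) - f (t, u t)) + t ^ n • (η t - η 0)) (by simp [hu0, hv0]) ?_ ?_
  · filter_upwards [hw] with t h1
    have h2 : HasDerivAt (fun t : ℂ => t ^ (n + 1) / (n + 1)) (t ^ n) t := by
      refine ((hasDerivAt_pow (n + 1) t).div_const ((n : ℂ) + 1)).congr_deriv ?_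
      rw [Nat.add_sub_cancel]
      push_cast
      field_simp
    exact (h1.fun_sub (h2.smul_const (η 0))).congr_deriv (by rw [smul_sub]; abel)
  · refine IsLittleO.add ?_ ?_
    · refine (hLip.trans (hO (n + 1) le_rfl)).trans_isLittleO ?_
      exact isLittleO_pow_pow (by lia)
    · have : (fun t => η t - η 0) =o[𝓝 0] fun _ => (1 : ℂ) := by
        rw [isLittleO_one_iff]
        simpa using hη.tendsto.sub_const (η 0)
      simpa using (isBigO_refl (fun t : ℂ => t ^ n) (𝓝 0)).smul_isLittleO this

end HolomorphicODE

/-! ### Vector fields and Lie brackets in the preferred chart. -/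

namespace JetExt

section ChartRep

open VectorField

variable {E : Type*} [NormedAddCommGroup E] [NormedSpace ℂ E]
  {H : Type*} [TopologicalSpace H] (I : ModelWithCorners ℂ E H)
  {M : Type*} [TopologicalSpace M] [ChartedSpace H M]

/-- The representation of a vector field in the preferred chart at `x₀`. -/
def chartRep (x₀ : M) (V : (x : M) → TangentSpace I x) : E → E :=
  mpullbackWithin 𝓘(ℂ, E) I (extChartAt I x₀).symm V (Set.range I)

variable {I}

lemma chartRep_apply (x₀ : M) (V : (x : M) → TangentSpace I x) (e : E) :
    chartRep I x₀ V e = (mfderivWithin 𝓘(ℂ, E) I (extChartAt I x₀).symm (Set.range I) e).inverse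
      (V ((extChartAt I x₀).symm e)) := rfl

variable [IsManifold I 1 M]

lemma eq_of_chartRep_eq {x₀ : M} {V W : (x : M) → TangentSpace I x}
    (h : chartRep I x₀ V (extChartAt I x₀ x₀) = chartRep I x₀ W (extChartAt I x₀ x₀)) :
    V x₀ = W x₀ := by
  have key : ∀ U : (x : M) → TangentSpace I x, U x₀ = mpullback I 𝓘(ℂ, E) (extChartAt I x₀)
      (mpullbackWithin 𝓘(ℂ, E) I (extChartAt I x₀).symm U (Set.range I)) x₀ := fun U => by
    have := eventuallyEq_mpullback_mpullbackWithin_extChartAt (I := I) (s := Set.univ) (x := x₀) U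
    rw [nhdsWithin_univ] at this
    exact this.self_of_nhds
  rw [key V, key W, mpullback_apply, mpullback_apply]
  exact congrArg _ h

lemma inverse_apply_inverse_apply {A D : E →L[ℂ] E} (h : A.comp D = .id ℂ E)
    (h' : D.comp A = .id ℂ E) (w : E) : A.inverse (D.inverse w) = w := by
  rw [ContinuousLinearMap.inverse_eq h h', ContinuousLinearMap.inverse_eq h' h]
  exact congrArg (fun L : E →L[ℂ] E => L w) h'

/-- The bracket at `x₀` is defined as the pull-back of the flat bracket in the preferred chart at
`x₀`, and `chartRep` undoes this pull-back. Evaluating at the centre of the chart avoids any change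
of charts, hence any regularity assumption. -/
lemma chartRep_mlieBracket [I.Boundaryless] (x₀ : M) (V W : (x : M) → TangentSpace I x) :
    chartRep I x₀ (mlieBracket I V W) (extChartAt I x₀ x₀)
      = lieBracket ℂ (chartRep I x₀ V) (chartRep I x₀ W) (extChartAt I x₀ x₀) := by
  have h0 : (extChartAt I x₀).symm (extChartAt I x₀ x₀) = x₀ := extChartAt_to_inv x₀
  have h3 := mfderiv_extChartAt_comp_mfderivWithin_extChartAt_symm'
    (mem_extChartAt_source (I := I) x₀)
  have h4 := mfderivWithin_extChartAt_symm_comp_mfderiv_extChartAt'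
    (mem_extChartAt_source (I := I) x₀)
  have hM : mlieBracket I V W x₀ = mpullback I 𝓘(ℂ, E) (extChartAt I x₀)
      (lieBracketWithin ℂ (mpullbackWithin 𝓘(ℂ, E) I (extChartAt I x₀).symm V (Set.range I))
        (mpullbackWithin 𝓘(ℂ, E) I (extChartAt I x₀).symm W (Set.range I))
        ((extChartAt I x₀).symm ⁻¹' Set.univ ∩ Set.range I)) x₀ :=
    congrFun mlieBracketWithin_def x₀
  have hB : lieBracket ℂ (chartRep I x₀ V) (chartRep I x₀ W) (extChartAt I x₀ x₀) =
      lieBracketWithin ℂ (chartRep I x₀ V) (chartRep I x₀ W)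
        ((extChartAt I x₀).symm ⁻¹' Set.univ ∩ Set.range I) (extChartAt I x₀ x₀) := by
    rw [Set.preimage_univ, Set.univ_inter, I.range_eq_univ, lieBracketWithin_univ]
  -- The two sides live in tangent spaces at different base points; `show E from` places both in
  -- `E`.
  have h5 : (show E from mlieBracket I V W ((extChartAt I x₀).symm (extChartAt I x₀ x₀)))
      = mlieBracket I V W x₀ := congrArg (fun y => (show E from mlieBracket I V W y)) h0
  rw [hB]
  exact ((congrArg (fun w : E => (show E →L[ℂ] E from (mfderivWithin 𝓘(ℂ, E) I
    (extChartAt I x₀).symm (Set.range I) (extChartAt I x₀ x₀))).inverse w) (h5.trans hM))).trans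
    (inverse_apply_inverse_apply (E := E) h4 h3 _)

end ChartRep

section Self

variable {E : Type*} [NormedAddCommGroup E] [NormedSpace ℂ E]
  {X : Type*} [TopologicalSpace X] [ChartedSpace E X] [IsManifold 𝓘(ℂ, E) ω X]

lemma contDiffAt_chartRep [CompleteSpace E] (x₀ : X) {V : VField E X}
    (hV : ContMDiffAt 𝓘(ℂ, E) 𝓘(ℂ, E).tangent ω (fun x => (⟨x, V x⟩ : TangentBundle 𝓘(ℂ, E) X)) x₀) :
    ContDiffAt ℂ ω (chartRep 𝓘(ℂ, E) x₀ V) (extChartAt 𝓘(ℂ, E) x₀ x₀) := by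
  have h := VectorField.contMDiffWithinAt_mpullbackWithin_extChartAt_symm (n := ω) (m := ω)
    hV.contMDiffWithinAt uniqueMDiffOn_univ (Set.mem_univ x₀) (by simp)
  rw [Set.preimage_univ, Set.inter_univ] at h
  have h2 := h.contMDiffAt ((isOpen_extChartAt_target x₀).mem_nhds (mem_extChartAt_target x₀))
  exact contMDiffAt_vectorSpace_iff_contDiffAt.1 h2

lemma inverse_prod_comp_fst_snd {L : E →L[ℂ] E} (hL : L.IsInvertible) (w : E × ℂ) :
    (((L.comp (.fst ℂ E ℂ)).prod (.snd ℂ E ℂ)) : E × ℂ →L[ℂ] E × ℂ).inverse w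
      = (L.inverse w.1, w.2) := by
  obtain ⟨A, rfl⟩ := hL
  rw [ContinuousLinearMap.inverse_eq
    (g := (((A.symm : E →L[ℂ] E).comp (.fst ℂ E ℂ)).prod (.snd ℂ E ℂ)))
    (by ext <;> simp) (by ext <;> simp)]
  simp

/-- The chart of `X × ℂ` is the chart of `X` times the identity, so its derivative is block
diagonal. The formula is needed on the whole chart target, because the bracket differentiates it. -/
lemma chartRep_prod_apply (x₀ : X) (t : ℂ) (V : ProdVField E X) {e : E}
    (he : e ∈ (extChartAt 𝓘(ℂ, E) x₀).target) (s : ℂ) :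
    chartRep (𝓘(ℂ, E).prod 𝓘(ℂ, ℂ)) (x₀, t) V (e, s)
      = (chartRep 𝓘(ℂ, E) x₀ (V.atTime s) e,
        (V ((extChartAt 𝓘(ℂ, E) x₀).symm e, s)).2) := by
  have : IsManifold 𝓘(ℂ, E) 1 X := .of_le (n := ω) le_top
  have hd : MDifferentiableAt 𝓘(ℂ, E) 𝓘(ℂ, E) (extChartAt 𝓘(ℂ, E) x₀).symm e := by
    have := mdifferentiableWithinAt_extChartAt_symm he
    rwa [ModelWithCorners.range_eq_univ, mdifferentiableWithinAt_univ] at this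
  have hinv := isInvertible_mfderivWithin_extChartAt_symm he
  have hfst : HasMFDerivAt 𝓘(ℂ, E × ℂ) 𝓘(ℂ, E) (Prod.fst : E × ℂ → E) (e, s)
    (ContinuousLinearMap.fst ℂ E ℂ) := hasFDerivAt_fst.hasMFDerivAt
  have hsnd : HasMFDerivAt 𝓘(ℂ, E × ℂ) 𝓘(ℂ, ℂ) (Prod.snd : E × ℂ → ℂ) (e, s)
    (ContinuousLinearMap.snd ℂ E ℂ) := hasFDerivAt_snd.hasMFDerivAt
  have hmf := (hd.hasMFDerivAt.comp (e, s) hfst).prodMk hsnd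
  have hchart : (extChartAt (𝓘(ℂ, E).prod 𝓘(ℂ, ℂ)) (x₀, t)).symm
      = fun q : E × ℂ => ((extChartAt 𝓘(ℂ, E) x₀).symm q.1, q.2) := by
    rw [extChartAt_prod]
    rfl
  let L : E →L[ℂ] E := mfderiv 𝓘(ℂ, E) 𝓘(ℂ, E) (extChartAt 𝓘(ℂ, E) x₀).symm e
  have hder : mfderivWithin 𝓘(ℂ, E × ℂ) (𝓘(ℂ, E).prod 𝓘(ℂ, ℂ))
      (extChartAt (𝓘(ℂ, E).prod 𝓘(ℂ, ℂ)) (x₀, t)).symm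
      (Set.range (𝓘(ℂ, E).prod 𝓘(ℂ, ℂ))) (e, s)
      = ((L.comp (.fst ℂ E ℂ)).prod (.snd ℂ E ℂ) : E × ℂ →L[ℂ] E × ℂ) := by
    rw [ModelWithCorners.range_eq_univ, mfderivWithin_univ, hchart]
    exact hmf.mfderiv
  have hV : (show E × ℂ from V ((extChartAt (𝓘(ℂ, E).prod 𝓘(ℂ, ℂ)) (x₀, t)).symm (e, s)))
      = V ((extChartAt 𝓘(ℂ, E) x₀).symm e, s) :=
    congrArg (fun p => (show E × ℂ from V p)) (congrFun hchart (e, s))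
  rw [ModelWithCorners.range_eq_univ, mfderivWithin_univ] at hinv
  refine (congrArg₂ (fun (L : E × ℂ →L[ℂ] E × ℂ) (w : E × ℂ) => L.inverse w) hder hV).trans ?_
  refine (inverse_prod_comp_fst_snd (L := L) hinv _).trans ?_
  rw [chartRep_apply, ModelWithCorners.range_eq_univ, mfderivWithin_univ]
  rfl

end Self
end JetExt

/-! ### Lie derivatives of fields that are polynomial in time. -/

namespace JetExt

section PolynomialBracket

open VectorField

variable {E : Type*} [NormedAddCommGroup E] [NormedSpace ℂ E]

lemma hasFDerivAt_sum_pow_smul {α : ℕ → E → E} {e : E} (t : ℂ)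
    (hα : ∀ i, DifferentiableAt ℂ (α i) e) (N : ℕ) (c : ℂ) :
    HasFDerivAt (fun q : E × ℂ => (∑ i ∈ Finset.range N, q.2 ^ i • α i q.1, c))
      ((∑ i ∈ Finset.range N, (t ^ i • (fderiv ℂ (α i) e).comp (.fst ℂ E ℂ)
        + ((i * t ^ (i - 1) : ℂ) • ContinuousLinearMap.snd ℂ E ℂ).smulRight (α i e))).prod 0)
      (e, t) := by
  refine HasFDerivAt.prodMk (HasFDerivAt.fun_sum fun i _ => ?_) (hasFDerivAt_const c _)
  have h1 : HasFDerivAt (fun q : E × ℂ => α i q.1) ((fderiv ℂ (α i) e).comp (.fst ℂ E ℂ)) (e, t) :=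
    (hα i).hasFDerivAt.comp (e, t) hasFDerivAt_fst
  have h2 : HasFDerivAt (fun q : E × ℂ => q.2 ^ i)
      ((i * t ^ (i - 1) : ℂ) • ContinuousLinearMap.snd ℂ E ℂ) (e, t) :=
    (hasDerivAt_pow i t).comp_hasFDerivAt (e, t) hasFDerivAt_snd
  exact h2.smul h1

/-- The component `1` of the first field produces the time derivative of the second; the component
`0` of the second prevents any time derivative of the first. -/
lemma lieBracket_sum_pow_smul {α β : ℕ → E → E} {e : E} (t : ℂ)
    (hα : ∀ i, DifferentiableAt ℂ (α i) e) (hβ : ∀ i, DifferentiableAt ℂ (β i) e) (N M : ℕ) :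
    lieBracket ℂ (fun q : E × ℂ => (∑ i ∈ Finset.range N, q.2 ^ i • α i q.1, (1 : ℂ)))
      (fun q : E × ℂ => (∑ i ∈ Finset.range M, q.2 ^ i • β i q.1, (0 : ℂ))) (e, t)
    = (∑ j ∈ Finset.range M, (j * t ^ (j - 1) : ℂ) • β j e
      + ∑ i ∈ Finset.range N, ∑ j ∈ Finset.range M, t ^ (i + j) • lieBracket ℂ (α i) (β j) e,
      (0 : ℂ)) := by
  have h1 : ∀ w : E, fderiv ℂ (fun q : E × ℂ => (∑ i ∈ Finset.range M, q.2 ^ i • β i q.1, (0 : ℂ)))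
      (e, t) (w, 1) = (∑ j ∈ Finset.range M, (j * t ^ (j - 1) : ℂ) • β j e
        + ∑ j ∈ Finset.range M, t ^ j • fderiv ℂ (β j) e w, 0) := fun w => by
    rw [(hasFDerivAt_sum_pow_smul t hβ M 0).fderiv]
    simp [add_comm, Finset.sum_add_distrib]
  have h2 : ∀ w : E, fderiv ℂ (fun q : E × ℂ => (∑ i ∈ Finset.range N, q.2 ^ i • α i q.1, (1 : ℂ)))
      (e, t) (w, 0) = (∑ i ∈ Finset.range N, t ^ i • fderiv ℂ (α i) e w, 0) := fun w => by
    rw [(hasFDerivAt_sum_pow_smul t hα N 1).fderiv]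
    simp
  rw [lieBracket_eq]
  beta_reduce
  rw [h1, h2, Prod.mk_sub_mk, sub_zero]
  simp only [lieBracket_eq, map_sum, map_smul, smul_sub, Finset.sum_sub_distrib,
    Finset.smul_sum, smul_smul, pow_add]
  rw [Finset.sum_comm (s := Finset.range M) (t := Finset.range N)]
  simp only [mul_comm, add_sub_assoc]

/-- Collects powers of `t`. Vanishing beyond `N` and `M` allows full antidiagonals, and every
exponent that occurs is below `N + M`. -/
lemma sum_range_coeff_bracket {β : ℕ → E} {γ : ℕ → ℕ → E} (t : ℂ) {N M : ℕ}
    (hβ : ∀ j ≥ M, β j = 0) (hγ : ∀ i j, N ≤ i ∨ M ≤ j → γ i j = 0) :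
    ∑ j ∈ Finset.range M, (j * t ^ (j - 1) : ℂ) • β j
      + ∑ i ∈ Finset.range N, ∑ j ∈ Finset.range M, t ^ (i + j) • γ i j
    = ∑ k ∈ Finset.range (N + M), t ^ k • (((k : ℂ) + 1) • β (k + 1)
      + ∑ p ∈ Finset.HasAntidiagonal.antidiagonal k, γ p.1 p.2) := by
  simp only [smul_add, Finset.sum_add_distrib]
  congr 1
  -- One index more than `N + M`: the term `j = 0` has factor zero and is split off in the shift `j
  -- = k + 1`.
  · have h1 : ∑ j ∈ Finset.range M, (j * t ^ (j - 1) : ℂ) • β j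
        = ∑ j ∈ Finset.range (N + M + 1), (j * t ^ (j - 1) : ℂ) • β j := by
      refine Finset.sum_subset (Finset.range_subset_range.2 (by lia)) fun j _ hj => ?_
      rw [hβ j (by simpa using hj), smul_zero]
    rw [h1, Finset.sum_range_succ']
    simp [smul_smul, mul_comm]
  · rw [← Finset.sum_product' (f := fun i j => t ^ (i + j) • γ i j),
      ← Finset.sum_fiberwise_of_maps_to (t := Finset.range (N + M)) (g := fun p => p.1 + p.2)
        (fun p hp => by simp only [Finset.mem_product, Finset.mem_range] at hp ⊢; lia)]
    refine Finset.sum_congr rfl fun k _ => ?_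
    rw [Finset.smul_sum]
    have hsub : (Finset.range N ×ˢ Finset.range M).filter (fun p => p.1 + p.2 = k)
        ⊆ Finset.HasAntidiagonal.antidiagonal k := fun p hp => by
      simpa using (Finset.mem_filter.1 hp).2
    rw [← Finset.sum_subset (f := fun p : ℕ × ℕ => t ^ k • γ p.1 p.2) hsub]
    · exact Finset.sum_congr rfl fun p hp => by rw [(Finset.mem_filter.1 hp).2]
    · intro p hp hp'
      have : N ≤ p.1 ∨ M ≤ p.2 := by
        by_contra! hcon
        exact hp' (Finset.mem_filter.2 ⟨by simpa using hcon, by simpa using hp⟩)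
      rw [hγ _ _ this, smul_zero]

end PolynomialBracket

section PolyField

open VectorField

variable {E : Type*} [NormedAddCommGroup E] [NormedSpace ℂ E]
  {X : Type*} [TopologicalSpace X] [ChartedSpace E X]

/-- The time-dependent vector field `∑_{i < N} tⁱ aᵢ`. -/
def polyField (a : ℕ → VField E X) (N : ℕ) : ProdVField E X :=
  fun p => (∑ i ∈ Finset.range N, p.2 ^ i • a i p.1, (0 : ℂ))

/-- The coefficients of `∂v/∂t + [a, v]` in terms of the coefficients of `a` and `v`. -/
def coeffLieD (a v : ℕ → VField E X) (k : ℕ) : VField E X :=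
  ((k : ℂ) + 1) • v (k + 1)
    + ∑ p ∈ Finset.HasAntidiagonal.antidiagonal k, mlieBracket 𝓘(ℂ, E) (a p.1) (v p.2)

lemma coeffLieD_eq_zero {a v : ℕ → VField E X} {N M : ℕ} (ha : ∀ i ≥ N, a i = 0)
    (hv : ∀ i ≥ M, v i = 0) : ∀ k ≥ N + M, coeffLieD a v k = 0 := by
  intro k hk
  rw [coeffLieD, hv (k + 1) (by lia), smul_zero, zero_add]
  refine Finset.sum_eq_zero fun p hp => ?_
  rw [Finset.HasAntidiagonal.mem_antidiagonal] at hp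
  rcases le_or_gt N p.1 with h | h
  · rw [ha _ h, mlieBracket_zero_left]
  · rw [hv _ (by lia), mlieBracket_zero_right]

lemma polyField_eq_of_le {a : ℕ → VField E X} {N N' : ℕ} (ha : ∀ i ≥ N, a i = 0) (h : N ≤ N') :
    polyField a N = polyField a N' := by
  funext p
  refine Prod.ext (Finset.sum_subset (Finset.range_subset_range.2 h) fun i _ hi => ?_) rfl
  rw [ha i (by simpa using hi)]
  exact smul_zero (M := ℂ) (A := E) _

lemma atTime_zero_polyField {a : ℕ → VField E X} {N : ℕ} (ha : ∀ i ≥ N, a i = 0) :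
    (polyField a N).atTime 0 = a 0 := by
  -- Enlarging the range ensures that the term `i = 0` is present even if `N = 0`.
  rw [polyField_eq_of_le ha N.le_succ]
  funext x
  change ∑ i ∈ Finset.range (N + 1), (0 : ℂ) ^ i • a i x = a 0 x
  rw [Finset.sum_range_succ']
  simp

/-- Degree `k` of `coeffLieD a v` sees degree `k + 1` of `v` only through `(k + 1) • v (k + 1)`,
while its brackets involve degrees at most `k`. The leading discrepancy thus descends one degree per
step and acquires the factors `p, p - 1, …`. -/
lemma iterate_coeffLieD_sub {a b : ℕ → VField E X} {p : ℕ} (hab : ∀ i < p, a i = b i) :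
    ∀ m ≤ p, (∀ k < p - m, (coeffLieD a)^[m] a k = (coeffLieD b)^[m] b k) ∧
      (coeffLieD b)^[m] b (p - m) - (coeffLieD a)^[m] a (p - m)
        = (p.descFactorial m : ℂ) • (b p - a p) := by
  intro m
  induction m with
  | zero => intro _; simpa using hab
  | succ m ih =>
    intro hm
    obtain ⟨h1, h2⟩ := ih (by lia)
    -- Below degree `p - m` both arguments of each bracket already agree.
    have hbr : ∀ k < p - m, ∑ q ∈ Finset.HasAntidiagonal.antidiagonal k,
          mlieBracket 𝓘(ℂ, E) (a q.1) ((coeffLieD a)^[m] a q.2)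
        = ∑ q ∈ Finset.HasAntidiagonal.antidiagonal k,
          mlieBracket 𝓘(ℂ, E) (b q.1) ((coeffLieD b)^[m] b q.2) := fun k hk => by
      refine Finset.sum_congr rfl fun q hq => ?_
      rw [Finset.HasAntidiagonal.mem_antidiagonal] at hq
      rw [hab q.1 (by lia), h1 q.2 (by lia)]
    simp only [Function.iterate_succ_apply']
    refine ⟨fun k hk => ?_, ?_⟩
    · rw [coeffLieD, coeffLieD, h1 (k + 1) (by lia), hbr k (by lia)]
    · rw [coeffLieD, coeffLieD, hbr _ (by lia), add_sub_add_right_eq_sub, ← smul_sub,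
        show p - (m + 1) + 1 = p - m by lia, h2, smul_smul, Nat.descFactorial_succ,
        Nat.cast_mul]
      congr 2
      rw [← Nat.cast_add_one]
      congr 1
      lia

lemma chartRep_sum_pow_smul (x₀ : X) (a : ℕ → VField E X) (N : ℕ) (s : ℂ) (e : E) :
    chartRep 𝓘(ℂ, E) x₀ (fun x => ∑ i ∈ Finset.range N, s ^ i • a i x) e
      = ∑ i ∈ Finset.range N, s ^ i • chartRep 𝓘(ℂ, E) x₀ (a i) e := by
  simp only [chartRep_apply, map_sum, map_smul]
  rfl

/-- Compared at each point in the chart centred there, where the bracket is the flat one. The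
right-hand side is again polynomial in time, so the lemma can be iterated. -/
lemma lieD_polyField [IsManifold 𝓘(ℂ, E) ω X] [CompleteSpace E] {a v : ℕ → VField E X} {N M : ℕ} (ha : ∀ i ≥ N, a i = 0)
    (hv : ∀ i ≥ M, v i = 0) (ha' : ∀ i, HolomorphicOn (a i) Set.univ)
    (hv' : ∀ i, HolomorphicOn (v i) Set.univ) :
    lieD (polyField a N) (polyField v M) = polyField (coeffLieD a v) (N + M) := by
  have : IsManifold 𝓘(ℂ, E) 1 X := .of_le (n := ω) le_top
  funext ⟨x, t⟩
  have hdiff : ∀ {V : VField E X}, HolomorphicOn V Set.univ →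
      DifferentiableAt ℂ (chartRep 𝓘(ℂ, E) x V) (extChartAt 𝓘(ℂ, E) x x) := fun hV =>
    (contDiffAt_chartRep x (hV.contMDiffAt Filter.univ_mem)).differentiableAt (by simp)
  have htarget : ∀ᶠ q : E × ℂ in 𝓝 (extChartAt 𝓘(ℂ, E) x x, t),
      q.1 ∈ (extChartAt 𝓘(ℂ, E) x).target :=
    continuousAt_fst.eventually_mem
      (show _ ∈ 𝓝 (extChartAt 𝓘(ℂ, E) x x) from extChartAt_target_mem_nhds x)
  have hpt : extChartAt (𝓘(ℂ, E).prod 𝓘(ℂ, ℂ)) (x, t) (x, t) = (extChartAt 𝓘(ℂ, E) x x, t) := by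
    rw [extChartAt_prod]
    rfl
  have h1 : chartRep (𝓘(ℂ, E).prod 𝓘(ℂ, ℂ)) (x, t) (constFlow (polyField a N))
      =ᶠ[𝓝 (extChartAt 𝓘(ℂ, E) x x, t)]
      fun q => (∑ i ∈ Finset.range N, q.2 ^ i • chartRep 𝓘(ℂ, E) x (a i) q.1, (1 : ℂ)) := by
    filter_upwards [htarget] with q hq
    rw [chartRep_prod_apply x t _ hq q.2, ← chartRep_sum_pow_smul]
    have hW : (constFlow (polyField a N)).atTime q.2
        = fun z => ∑ i ∈ Finset.range N, q.2 ^ i • a i z := by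
      funext z
      exact zero_add (M := E) _
    rw [hW]
    exact Prod.ext rfl (add_zero (1 : ℂ))
  have h2 : ∀ (w : ℕ → VField E X) (K : ℕ) (q : E × ℂ), q.1 ∈ (extChartAt 𝓘(ℂ, E) x).target →
      chartRep (𝓘(ℂ, E).prod 𝓘(ℂ, ℂ)) (x, t) (polyField w K) q
      = (∑ i ∈ Finset.range K, q.2 ^ i • chartRep 𝓘(ℂ, E) x (w i) q.1, (0 : ℂ)) := by
    intro w K q hq
    rw [chartRep_prod_apply x t _ hq q.2, ← chartRep_sum_pow_smul]
    rfl
  refine eq_of_chartRep_eq ?_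
  rw [lieD, chartRep_mlieBracket, hpt, h1.lieBracket_vectorField_eq (htarget.mono (h2 v M)),
    lieBracket_sum_pow_smul t (fun i => hdiff (ha' i)) (fun i => hdiff (hv' i)),
    h2 _ _ _ (mem_extChartAt_target x)]
  have hz : chartRep 𝓘(ℂ, E) x (0 : VField E X) = 0 := mpullbackWithin_zero
  rw [sum_range_coeff_bracket]
  · refine congrArg (·, (0 : ℂ)) (Finset.sum_congr rfl fun k _ => congrArg (t ^ k • ·) ?_)
    have hsum : chartRep 𝓘(ℂ, E) x (coeffLieD a v k) (extChartAt 𝓘(ℂ, E) x x)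
        = ((k : ℂ) + 1) • chartRep 𝓘(ℂ, E) x (v (k + 1)) (extChartAt 𝓘(ℂ, E) x x)
          + ∑ p ∈ Finset.HasAntidiagonal.antidiagonal k, chartRep 𝓘(ℂ, E) x
            (mlieBracket 𝓘(ℂ, E) (a p.1) (v p.2)) (extChartAt 𝓘(ℂ, E) x x) := by
      simp only [chartRep_apply, coeffLieD, Pi.add_apply, Pi.smul_apply, Finset.sum_apply,
        map_add, map_smul, map_sum]
      rfl
    rw [hsum]
    simp only [chartRep_mlieBracket]
  · intro j hj
    rw [hv j hj, hz]
    rfl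
  · rintro i j (h | h)
    · rw [ha i h, hz, lieBracket_zero_left]; rfl
    · rw [hv j h, hz, lieBracket_zero_right]; rfl

end PolyField
end JetExt

/-! ### Asymptotics and Taylor coefficients. -/

namespace JetExt

section Taylor

open Asymptotics Filter

/-- If the order of vanishing were `d ≤ m`, then `g = t ^ d • q` with `q 0 ≠ 0` near `0`, which is
not `o(t ^ d)`. -/
lemma iteratedDeriv_eq_zero_of_isLittleO {g : ℂ → ℂ} {m : ℕ} (hg : AnalyticAt ℂ g 0)
    (h : g =o[𝓝 0] fun t => t ^ m) {k : ℕ} (hk : k ≤ m) : iteratedDeriv k g 0 = 0 := by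
  have hle : ((m + 1 : ℕ) : ℕ∞) ≤ analyticOrderAt g 0 := by
    by_contra! hlt
    obtain ⟨d, hd⟩ := ENat.ne_top_iff_exists.1 hlt.ne_top
    rw [← hd, Nat.cast_lt] at hlt
    obtain ⟨q, hq, hq0, hgq⟩ := hg.analyticOrderAt_eq_natCast.1 hd.symm
    have hpow : (fun t : ℂ => t ^ m) =O[𝓝 0] fun t => t ^ d := IsBigO.of_bound 1 (by
      filter_upwards [Metric.ball_mem_nhds (0 : ℂ) one_pos] with t ht
      rw [norm_pow, norm_pow, one_mul]
      exact pow_le_pow_of_le_one (norm_nonneg t) (mem_ball_zero_iff.1 ht).le (by lia))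
    have h1 := (h.trans_isBigO hpow).bound (c := ‖q 0‖ / 2) (by positivity)
    have h2 : ∀ᶠ t in 𝓝 (0 : ℂ), ‖q 0‖ / 2 < ‖q t‖ :=
      hq.continuousAt.norm.eventually_const_lt (by linarith [norm_pos_iff.2 hq0])
    have h3 : ∀ᶠ t in 𝓝[≠] (0 : ℂ), False := by
      filter_upwards [nhdsWithin_le_nhds (h1.and (h2.and hgq)), self_mem_nhdsWithin]
        with t ⟨h1, h2, h3⟩ ht
      rw [h3, sub_zero, norm_smul, mul_comm] at h1
      exact absurd (le_of_mul_le_mul_right h1 (norm_pos_iff.2 (pow_ne_zero d ht))) h2.not_ge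
    exact h3.exists.elim fun _ h => h
  exact (natCast_le_analyticOrderAt_iff_iteratedDeriv_eq_zero hg).1 hle k (by lia)

lemma iteratedDeriv_eq_of_isLittleO {f g : ℂ → ℂ} {m : ℕ} {c : ℂ} (hf : AnalyticAt ℂ f 0)
    (hg : AnalyticAt ℂ g 0)
    (h : (fun t => g t - f t - t ^ m * c) =o[𝓝 0] fun t => t ^ m) {k : ℕ} (hk : k ≤ m) :
    iteratedDeriv k g 0 = iteratedDeriv k f 0 + if k = m then m.factorial * c else 0 := by
  have hp : AnalyticAt ℂ (fun t : ℂ => t ^ m * c) 0 := by fun_prop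
  have h0 := iteratedDeriv_eq_zero_of_isLittleO ((hg.fun_sub hf).fun_sub hp) h hk
  rw [show (fun t => g t - f t - t ^ m * c) = (g - f) - fun t => c * t ^ m by
      funext t; simp [mul_comm],
    iteratedDeriv_sub (hg.sub hf).contDiffAt (by fun_prop),
    iteratedDeriv_sub hg.contDiffAt hf.contDiffAt, iteratedDeriv_const_mul_field,
    iteratedDeriv_fun_pow_zero] at h0
  rw [sub_eq_zero, sub_eq_iff_eq_add'] at h0
  rw [h0]
  split_ifs <;> simp_all [mul_comm]

end Taylor

/-! ### Integral curves in charts. -/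

section ChartRepDerivative

variable {E : Type*} [NormedAddCommGroup E] [NormedSpace ℂ E]
  {X : Type*} [TopologicalSpace X] [ChartedSpace E X] [IsManifold 𝓘(ℂ, E) 1 X]

/-- The derivative of the preferred chart at `x₀`. -/
def chartDeriv (x₀ z : X) : E →L[ℂ] E := mfderiv 𝓘(ℂ, E) 𝓘(ℂ, E) (extChartAt 𝓘(ℂ, E) x₀) z

/-- The derivative of the inverse of the preferred chart at `x₀`. -/
def chartSymmDeriv (x₀ : X) (e : E) : E →L[ℂ] E :=
  mfderiv 𝓘(ℂ, E) 𝓘(ℂ, E) (extChartAt 𝓘(ℂ, E) x₀).symm e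

lemma chartRep_extChartAt {x₀ z : X} (V : VField E X) (hz : z ∈ (extChartAt 𝓘(ℂ, E) x₀).source) :
    chartRep 𝓘(ℂ, E) x₀ V (extChartAt 𝓘(ℂ, E) x₀ z)
      = chartDeriv (E := E) x₀ z (V z) := by
  have h3 := mfderiv_extChartAt_comp_mfderivWithin_extChartAt_symm' hz
  have h4 := mfderivWithin_extChartAt_symm_comp_mfderiv_extChartAt' hz
  have h5 : (show E from V ((extChartAt 𝓘(ℂ, E) x₀).symm (extChartAt 𝓘(ℂ, E) x₀ z))) = V z :=
    congrArg (fun y => (show E from V y)) ((extChartAt 𝓘(ℂ, E) x₀).left_inv hz)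
  exact congrArg₂ (fun (L : E →L[ℂ] E) (w : E) => L w)
    (ContinuousLinearMap.inverse_eq (M := E) (M₂ := E) h4 h3) h5

lemma mfderiv_extChartAt_symm_chartRep {x₀ : X} (V : VField E X) {e : E}
    (he : e ∈ (extChartAt 𝓘(ℂ, E) x₀).target) :
    chartSymmDeriv x₀ e (chartRep 𝓘(ℂ, E) x₀ V e)
      = V ((extChartAt 𝓘(ℂ, E) x₀).symm e) := by
  have h := isInvertible_mfderivWithin_extChartAt_symm he
  rw [ModelWithCorners.range_eq_univ, mfderivWithin_univ] at h
  have h1 : chartRep 𝓘(ℂ, E) x₀ V e = (chartSymmDeriv x₀ e).inverse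
      (V ((extChartAt 𝓘(ℂ, E) x₀).symm e)) := by
    rw [chartRep_apply, ModelWithCorners.range_eq_univ, mfderivWithin_univ]
    rfl
  have h' : (chartSymmDeriv x₀ e).IsInvertible := h
  exact (h'.inverse_apply_eq.1 h1.symm).symm

/-- The integral curves of `A`, written in a chart, satisfy an ordinary differential equation. -/
lemma IsIntegralCurveGerm.eventually_hasDerivAt {A : ProdVField E X} {x₀ : X} {γ : ℂ → X}
    (h : IsIntegralCurveGerm A x₀ γ) :
    ∀ᶠ t in 𝓝 (0 : ℂ), HasDerivAt (fun t => extChartAt 𝓘(ℂ, E) x₀ (γ t))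
      (chartRep 𝓘(ℂ, E) x₀ (A.atTime t) (extChartAt 𝓘(ℂ, E) x₀ (γ t))) t := by
  have hsrc : ∀ᶠ t in 𝓝 (0 : ℂ), γ t ∈ (extChartAt 𝓘(ℂ, E) x₀).source :=
    h.holomorphic.continuousAt.eventually_mem
      (by rw [h.initial]; exact extChartAt_source_mem_nhds x₀)
  filter_upwards [hsrc, h.deriv] with t ht hd
  rw [chartRep_extChartAt _ ht]
  have h1 := (mdifferentiableAt_extChartAt (I := 𝓘(ℂ, E))
    (by rwa [extChartAt_source] at ht)).hasMFDerivAt.comp t hd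
  have h2 : HasFDerivAt (fun t => extChartAt 𝓘(ℂ, E) x₀ (γ t))
      ((chartDeriv (E := E) x₀ (γ t)).comp ((1 : ℂ →L[ℂ] ℂ).smulRight
        (show E from A.atTime t (γ t)))) t := hasMFDerivAt_iff_hasFDerivAt.1 h1
  refine h2.hasDerivAt.congr_deriv ?_
  exact congrArg (chartDeriv (E := E) x₀ (γ t)) (one_smul ℂ (show E from A.atTime t (γ t)))

lemma exists_isIntegralCurveGerm [CompleteSpace E] [IsManifold 𝓘(ℂ, E) ω X] {A : ProdVField E X}
    {x₀ : X}
    (hA : ContDiffAt ℂ 1 (fun q : ℂ × E => chartRep 𝓘(ℂ, E) x₀ (A.atTime q.1) q.2)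
      (0, extChartAt 𝓘(ℂ, E) x₀ x₀)) :
    ∃ γ, IsIntegralCurveGerm A x₀ γ := by
  obtain ⟨u, hu0, hu⟩ := exists_eventually_hasDerivAt_of_contDiffAt hA
  have hmem : extChartAt 𝓘(ℂ, E) x₀ x₀ ∈ (extChartAt 𝓘(ℂ, E) x₀).target := mem_extChartAt_target x₀
  have hua : AnalyticAt ℂ u 0 := Complex.analyticAt_iff_eventually_differentiableAt.2
    (hu.mono fun t ht => ht.differentiableAt)
  refine ⟨fun t => (extChartAt 𝓘(ℂ, E) x₀).symm (u t), ?_, ?_, ?_⟩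
  · rw [hu0]
    exact extChartAt_to_inv x₀
  · have h1 : ContMDiffAt 𝓘(ℂ, E) 𝓘(ℂ, E) ω (extChartAt 𝓘(ℂ, E) x₀).symm (u 0) := by
      rw [hu0]
      exact (contMDiffOn_extChartAt_symm x₀).contMDiffAt
        ((isOpen_extChartAt_target x₀).mem_nhds hmem)
    exact h1.comp 0 hua.contDiffAt.contMDiffAt
  · have htgt : ∀ᶠ t in 𝓝 (0 : ℂ), u t ∈ (extChartAt 𝓘(ℂ, E) x₀).target :=
      hua.continuousAt.eventually_mem
        (by rw [hu0]; exact (isOpen_extChartAt_target x₀).mem_nhds hmem)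
    filter_upwards [hu, htgt] with t ht hut
    have hd : MDifferentiableAt 𝓘(ℂ, E) 𝓘(ℂ, E) (extChartAt 𝓘(ℂ, E) x₀).symm (u t) := by
      have := mdifferentiableWithinAt_extChartAt_symm hut
      rwa [ModelWithCorners.range_eq_univ, mdifferentiableWithinAt_univ] at this
    refine (hd.hasMFDerivAt.comp t ht.hasFDerivAt.hasMFDerivAt).congr_mfderiv ?_
    refine ContinuousLinearMap.ext fun s => ?_
    refine (map_smul (chartSymmDeriv x₀ (u t)) (show ℂ from s) _).trans ?_
    exact congrArg (fun w : E => (show ℂ from s) • w) (mfderiv_extChartAt_symm_chartRep (A.atTime t) hut)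

/-- Excludes the constant placeholder in `integralCurve`. -/
lemma isIntegralCurveGerm_integralCurve [CompleteSpace E] [IsManifold 𝓘(ℂ, E) ω X]
    {A : ProdVField E X} {x₀ : X}
    (hA : ContDiffAt ℂ 1 (fun q : ℂ × E => chartRep 𝓘(ℂ, E) x₀ (A.atTime q.1) q.2)
      (0, extChartAt 𝓘(ℂ, E) x₀ x₀)) :
    IsIntegralCurveGerm A x₀ (integralCurve A x₀) := by
  have h := exists_isIntegralCurveGerm hA
  rw [integralCurve, dif_pos h]
  exact h.choose_spec

end ChartRepDerivative

end JetExt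

/-! ### Effect of a perturbation of the field on derivatives along integral curves. -/

namespace JetExt

section JetComparison

open Asymptotics Filter

variable {E : Type*} [NormedAddCommGroup E] [NormedSpace ℂ E]
  {X : Type*} [TopologicalSpace X] [ChartedSpace E X] [IsManifold 𝓘(ℂ, E) ω X]

lemma contDiffAt_chartRep_polyField [CompleteSpace E] {a : ℕ → VField E X}
    (ha : ∀ i, HolomorphicOn (a i) Set.univ) (N : ℕ) (x₀ : X) :
    ContDiffAt ℂ 1 (fun q : ℂ × E => chartRep 𝓘(ℂ, E) x₀ ((polyField a N).atTime q.1) q.2)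
      (0, extChartAt 𝓘(ℂ, E) x₀ x₀) := by
  have h : (fun q : ℂ × E => chartRep 𝓘(ℂ, E) x₀ ((polyField a N).atTime q.1) q.2)
      = fun q => ∑ i ∈ Finset.range N, q.1 ^ i • chartRep 𝓘(ℂ, E) x₀ (a i) q.2 :=
    funext fun q => chartRep_sum_pow_smul x₀ a N q.1 q.2
  rw [h]
  refine ContDiffAt.sum fun i _ => (contDiffAt_fst.pow i).smul ?_
  exact ((contDiffAt_chartRep x₀ ((ha i).contMDiffAt univ_mem)).of_le le_top).comp
    (0, extChartAt 𝓘(ℂ, E) x₀ x₀) contDiffAt_snd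

lemma mfderiv_apply_eq_fderiv_chartRep {x₀ : X} (V : VField E X) {f : X → ℂ}
    (hf : ContMDiffAt 𝓘(ℂ, E) 𝓘(ℂ, ℂ) ω f x₀) :
    (show ℂ from mfderiv 𝓘(ℂ, E) 𝓘(ℂ, ℂ) f x₀ (V x₀))
      = fderiv ℂ (f ∘ (extChartAt 𝓘(ℂ, E) x₀).symm) (extChartAt 𝓘(ℂ, E) x₀ x₀)
        (chartRep 𝓘(ℂ, E) x₀ V (extChartAt 𝓘(ℂ, E) x₀ x₀)) := by
  have : IsManifold 𝓘(ℂ, E) 1 X := .of_le (n := ω) le_top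
  rw [chartRep_extChartAt V (mem_extChartAt_source x₀)]
  have h2 := (mdifferentiableAt_extChartAt (I := 𝓘(ℂ, E)) (mem_chart_source E x₀)).hasMFDerivAt
  have hG : DifferentiableAt ℂ (f ∘ (extChartAt 𝓘(ℂ, E) x₀).symm)
      (extChartAt 𝓘(ℂ, E) x₀ x₀) := by
    have := (contMDiffAt_iff.1 hf).2
    simp only [ModelWithCorners.range_eq_univ, contDiffWithinAt_univ] at this
    exact this.differentiableAt (by simp)
  have h3 : HasMFDerivAt 𝓘(ℂ, E) 𝓘(ℂ, ℂ)
      ((f ∘ (extChartAt 𝓘(ℂ, E) x₀).symm) ∘ extChartAt 𝓘(ℂ, E) x₀) x₀ _ :=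
    hG.hasFDerivAt.hasMFDerivAt.comp x₀ h2
  have h4 : f =ᶠ[𝓝 x₀] (f ∘ (extChartAt 𝓘(ℂ, E) x₀).symm) ∘ extChartAt 𝓘(ℂ, E) x₀ := by
    filter_upwards [extChartAt_source_mem_nhds (I := 𝓘(ℂ, E)) x₀] with z hz
    exact congrArg f ((extChartAt 𝓘(ℂ, E) x₀).left_inv hz).symm
  have h5 := (h3.congr_of_eventuallyEq h4).mfderiv
  exact congrArg (fun L : E →L[ℂ] ℂ => L (V x₀)) h5

/-- In a chart, the perturbation theorem gives the leading difference of the two curves, and the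
derivative of `f` carries it to `ℂ`. Any two integral curve germs are allowed, so uniqueness of
solutions plays no role. -/
lemma iteratedDeriv_comp_isIntegralCurveGerm [CompleteSpace E] {A B : ProdVField E X} {x₀ : X}
    {n : ℕ} {V W : VField E X}
    (hV : ContMDiffAt 𝓘(ℂ, E) 𝓘(ℂ, E).tangent ω
      (fun x => (⟨x, V x⟩ : TangentBundle 𝓘(ℂ, E) X)) x₀)
    (hW : ContMDiffAt 𝓘(ℂ, E) 𝓘(ℂ, E).tangent ω
      (fun x => (⟨x, W x⟩ : TangentBundle 𝓘(ℂ, E) X)) x₀)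
    (hA : ContDiffAt ℂ 1 (fun q : ℂ × E => chartRep 𝓘(ℂ, E) x₀ (A.atTime q.1) q.2)
      (0, extChartAt 𝓘(ℂ, E) x₀ x₀))
    (hAB : ∀ t, B.atTime t = A.atTime t + t ^ n • ((n.factorial : ℂ)⁻¹ • V + t • W))
    {γ δ : ℂ → X} (hγ : IsIntegralCurveGerm A x₀ γ) (hδ : IsIntegralCurveGerm B x₀ δ)
    {f : X → ℂ} (hf : ContMDiffAt 𝓘(ℂ, E) 𝓘(ℂ, ℂ) ω f x₀) {k : ℕ} (hk : k ≤ n + 1) :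
    iteratedDeriv k (f ∘ δ) 0 = iteratedDeriv k (f ∘ γ) 0
      + if k = n + 1 then (show ℂ from mfderiv 𝓘(ℂ, E) 𝓘(ℂ, ℂ) f x₀ (V x₀)) else 0 := by
  have : IsManifold 𝓘(ℂ, E) 1 X := .of_le (n := ω) le_top
  set φ := extChartAt 𝓘(ℂ, E) x₀ with hφ
  set G : E → ℂ := f ∘ φ.symm with hG
  have hG' : ContDiffAt ℂ ω G (φ x₀) := by
    have := (contMDiffAt_iff.1 hf).2
    simp only [ModelWithCorners.range_eq_univ, contDiffWithinAt_univ] at this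
    exact this
  have hu := hγ.eventually_hasDerivAt
  have hv := hδ.eventually_hasDerivAt
  rw [← hφ] at hu hv
  have hcv : ContinuousAt (fun t => φ (δ t)) 0 := hv.self_of_nhds.continuousAt
  have hcu : ContinuousAt (fun t => φ (γ t)) 0 := hu.self_of_nhds.continuousAt
  have hv0 : φ (δ 0) = φ x₀ := by rw [hδ.initial]
  have hu0 : φ (γ 0) = φ x₀ := by rw [hγ.initial]
  -- Evaluated along `δ`, so that `δ` solves the equation of `A` with the extra term `t ^ n • η t`.
  set η : ℂ → E := fun t => (n.factorial : ℂ)⁻¹ • chartRep 𝓘(ℂ, E) x₀ V (φ (δ t))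
    + t • chartRep 𝓘(ℂ, E) x₀ W (φ (δ t)) with hη
  have hrep : ∀ t e, chartRep 𝓘(ℂ, E) x₀ (B.atTime t) e = chartRep 𝓘(ℂ, E) x₀ (A.atTime t) e
      + t ^ n • ((n.factorial : ℂ)⁻¹ • chartRep 𝓘(ℂ, E) x₀ V e
        + t • chartRep 𝓘(ℂ, E) x₀ W e) := fun t e => by
    rw [hAB]
    simp only [chartRep_apply, Pi.add_apply, Pi.smul_apply, map_add, map_smul]
    rfl
  have hηc : ContinuousAt η 0 := by
    have h1 : ContinuousAt (fun t => chartRep 𝓘(ℂ, E) x₀ V (φ (δ t))) 0 :=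
      ContinuousAt.comp_of_eq (contDiffAt_chartRep x₀ hV).continuousAt hcv hv0
    have h2 : ContinuousAt (fun t => chartRep 𝓘(ℂ, E) x₀ W (φ (δ t))) 0 :=
      ContinuousAt.comp_of_eq (contDiffAt_chartRep x₀ hW).continuousAt hcv hv0
    exact (h1.const_smul _).add (continuousAt_id.smul h2)
  have hdiff := isLittleO_sub_of_hasDerivAt_perturbation (n := n) (η := η) hA hu0 hv0 hu
    (by filter_upwards [hv] with t ht using ht.congr_deriv (hrep t _)) hηc
  have hbig : (fun t => φ (δ t) - φ (γ t)) =O[𝓝 0] fun t : ℂ => t ^ (n + 1) := by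
    have h1 : (fun t : ℂ => (t ^ (n + 1) / (n + 1)) • η 0) =O[𝓝 0] fun t => t ^ (n + 1) := by
      refine IsBigO.of_bound (‖((n : ℂ) + 1)⁻¹‖ * ‖η 0‖) (.of_forall fun t => ?_)
      rw [norm_smul, div_eq_mul_inv, norm_mul]
      exact le_of_eq (by ring)
    simpa using hdiff.isBigO.add h1
  set L := fderiv ℂ G (φ x₀) with hL
  -- Strict differentiability compares `G` at two moving points with error `o(φ (δ t) - φ (γ t))`;
  -- linearising at `φ x₀` alone would not give `o(tⁿ⁺¹)`.
  have hstrict := (hG'.hasStrictFDerivAt (by simp)).isLittleO.comp_tendsto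
    (show Tendsto (fun t => (φ (δ t), φ (γ t))) (𝓝 0) (𝓝 (φ x₀, φ x₀)) by
      simpa only [hv0, hu0] using (hcv.prodMk hcu).tendsto)
  have hsrc : ∀ {σ : ℂ → X}, σ 0 = x₀ → ContMDiffAt 𝓘(ℂ, ℂ) 𝓘(ℂ, E) ω σ 0 →
      ∀ᶠ t in 𝓝 (0 : ℂ), G (φ (σ t)) = f (σ t) := fun {σ} h0 hσ => by
    have h1 : ∀ᶠ t in 𝓝 (0 : ℂ), σ t ∈ φ.source := hσ.continuousAt.eventually_mem
      (by rw [h0]; exact extChartAt_source_mem_nhds x₀)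
    filter_upwards [h1] with t ht
    simp [hG, φ.left_inv ht]
  have hana : ∀ {σ : ℂ → X}, σ 0 = x₀ → ContMDiffAt 𝓘(ℂ, ℂ) 𝓘(ℂ, E) ω σ 0 →
      AnalyticAt ℂ (f ∘ σ) 0 := fun {σ} h0 hσ => by
    subst h0
    exact (contMDiffAt_iff_contDiffAt.1 (ContMDiffAt.comp (0 : ℂ) hf hσ)).analyticAt
  have hfinal : (fun t => (f ∘ δ) t - (f ∘ γ) t - t ^ (n + 1) * (L (η 0) / (n + 1)))
      =o[𝓝 0] fun t : ℂ => t ^ (n + 1) := by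
    refine ((hstrict.trans_isBigO hbig).add
      ((L.isBigO_comp (fun t => φ (δ t) - φ (γ t) - (t ^ (n + 1) / (n + 1)) • η 0)
        (𝓝 0)).trans_isLittleO hdiff)).congr' ?_ .rfl
    filter_upwards [hsrc hγ.initial hγ.holomorphic, hsrc hδ.initial hδ.holomorphic] with t h1 h2
    simp only [Function.comp_apply, h1, h2, map_sub, map_smul, smul_eq_mul]
    ring
  rw [iteratedDeriv_eq_of_isLittleO (hana hγ.initial hγ.holomorphic)
    (hana hδ.initial hδ.holomorphic) hfinal hk]
  congr 2
  rw [mfderiv_apply_eq_fderiv_chartRep V hf, ← hφ, ← hG, ← hL]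
  have hη0 : η 0 = (n.factorial : ℂ)⁻¹ • chartRep 𝓘(ℂ, E) x₀ V (φ x₀) := by
    simp [hη, hv0]
  have h1 : (n.factorial : ℂ) ≠ 0 := Nat.cast_ne_zero.2 n.factorial_ne_zero
  have h2 : (n : ℂ) + 1 ≠ 0 := Nat.cast_add_one_ne_zero n
  rw [hη0, map_smul, smul_eq_mul, Nat.factorial_succ]
  push_cast
  field_simp

end JetComparison

end JetExt

/-! ### From derivatives along curves to jets. -/

namespace JetExt

section JetExtensionality

variable {E : Type*} [NormedAddCommGroup E] [NormedSpace ℂ E]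
  {X : Type*} [TopologicalSpace X] [ChartedSpace E X]

lemma Jet.ext_germ {n : ℕ} {x : X} {σ τ : Jet E n x}
    (h : ∀ (f : X → ℂ) (hf : ContMDiffAt 𝓘(ℂ, E) 𝓘(ℂ, ℂ) ω f x),
      σ (germ E f hf) = τ (germ E f hf)) : σ = τ := by
  refine AlgHom.ext fun s => ?_
  obtain ⟨f, rfl⟩ := Ideal.Quotient.mk_surjective s
  exact h f.1 f.2

variable {x : X} {A B : ProdVField E X} {n : ℕ} {v : TangentSpace 𝓘(ℂ, E) x}

lemma inducedJet_eq_of_iteratedDeriv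
    (h : ∀ f : X → ℂ, ContMDiffAt 𝓘(ℂ, E) 𝓘(ℂ, ℂ) ω f x → ∀ k ≤ n,
      iteratedDeriv k (f ∘ integralCurve B x) 0 = iteratedDeriv k (f ∘ integralCurve A x) 0) :
    inducedJet n A x = inducedJet n B x := by
  refine Jet.ext_germ fun f hf => mk_eq_mk_of_coeff fun k hk => ?_
  rw [taylorPoly_coeff n _ k hk, taylorPoly_coeff n _ k hk]
  exact congrArg (· / (k.factorial : ℂ)) (h f hf k (by lia)).symm

lemma hasDifference_inducedJet_of_iteratedDeriv
    (h : ∀ f : X → ℂ, ContMDiffAt 𝓘(ℂ, E) 𝓘(ℂ, ℂ) ω f x → ∀ k ≤ n + 1,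
      iteratedDeriv k (f ∘ integralCurve B x) 0 = iteratedDeriv k (f ∘ integralCurve A x) 0
        + if k = n + 1 then (show ℂ from mfderiv 𝓘(ℂ, E) 𝓘(ℂ, ℂ) f x v) else 0) :
    (inducedJet (n + 1) B x).HasDifference (inducedJet (n + 1) A x) v := by
  refine ⟨Jet.ext_germ fun f hf => ?_, fun f hf => ?_⟩
  · refine mk_eq_mk_of_coeff fun k hk => ?_
    rw [taylorPoly_coeff _ _ k (by lia), taylorPoly_coeff _ _ k (by lia)]
    have := h f hf k (by lia)
    rw [if_neg (by lia), add_zero] at this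
    exact congrArg (· / (k.factorial : ℂ)) this
  · change Ideal.Quotient.mk _ (taylorPoly (n + 1) (f ∘ integralCurve B x))
      - Ideal.Quotient.mk _ (taylorPoly (n + 1) (f ∘ integralCurve A x)) = _
    rw [← map_sub]
    refine mk_eq_mk_of_coeff fun k hk => ?_
    rw [Polynomial.coeff_sub, taylorPoly_coeff _ _ k hk, taylorPoly_coeff _ _ k hk,
      h f hf k (by lia), Polynomial.coeff_C_mul_X_pow]
    split_ifs with hkn
    · subst hkn
      have key : ∀ p q r : ℂ, (p + q) / r - p / r = q / r := fun p q r => by ring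
      exact key _ _ _
    · ring

end JetExtensionality

/-! ### Iterated Lie derivatives within `F`, and the construction of `B`. -/

section Construction

variable {E : Type*} [NormedAddCommGroup E] [NormedSpace ℂ E]
  {X : Type*} [TopologicalSpace X] [ChartedSpace E X] [IsManifold 𝓘(ℂ, E) ω X]

lemma TangentSubsheaf.LieClosed.coeffLieD_mem {F : TangentSubsheaf E X} (hF : F.LieClosed)
    {a v : ℕ → VField E X} (ha : ∀ i, a i ∈ F.sections ⊤) (hv : ∀ i, v i ∈ F.sections ⊤) (k : ℕ) :
    coeffLieD a v k ∈ F.sections ⊤ :=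
  add_mem (Submodule.smul_mem _ _ (hv _)) (sum_mem fun _ _ => hF _ _ (ha _) _ (hv _))

lemma TangentSubsheaf.LieClosed.iterate_coeffLieD_mem {F : TangentSubsheaf E X} (hF : F.LieClosed)
    {a : ℕ → VField E X} (ha : ∀ i, a i ∈ F.sections ⊤) (m : ℕ) :
    ∀ k, (coeffLieD a)^[m] a k ∈ F.sections ⊤ := by
  induction m with
  | zero => exact ha
  | succ m ih =>
    rw [Function.iterate_succ_apply']
    exact hF.coeffLieD_mem ha ih

lemma TangentSubsheaf.LieClosed.exists_iterate_lieD_eq [CompleteSpace E] {F : TangentSubsheaf E X}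
    (hF : F.LieClosed) {a : ℕ → VField E X} (ha : ∀ i, a i ∈ F.sections ⊤) {N : ℕ}
    (haN : ∀ i ≥ N, a i = 0) (m : ℕ) :
    ∃ M, (∀ i ≥ M, (coeffLieD a)^[m] a i = 0) ∧
      (lieD (polyField a N))^[m] (polyField a N) = polyField ((coeffLieD a)^[m] a) M := by
  induction m with
  | zero => exact ⟨N, haN, rfl⟩
  | succ m ih =>
    obtain ⟨M, hM, h⟩ := ih
    simp only [Function.iterate_succ_apply', h]
    exact ⟨N + M, coeffLieD_eq_zero haN hM, lieD_polyField haN hM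
      (fun i => F.holomorphic ⊤ _ (ha i))
      (fun i => F.holomorphic ⊤ _ (hF.iterate_coeffLieD_mem ha m i))⟩

lemma TangentSubsheaf.LieClosed.atTime_zero_iterate_lieD [CompleteSpace E]
    {F : TangentSubsheaf E X} (hF : F.LieClosed) {a : ℕ → VField E X}
    (ha : ∀ i, a i ∈ F.sections ⊤) {N : ℕ} (haN : ∀ i ≥ N, a i = 0) (m : ℕ) :
    ProdVField.atTime ((lieD (polyField a N))^[m] (polyField a N)) 0 = (coeffLieD a)^[m] a 0 := by
  obtain ⟨M, hM, h⟩ := hF.exists_iterate_lieD_eq ha haN m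
  rw [h, atTime_zero_polyField hM]

lemma IsTimeDependentIn.exists_eq_polyField {F : TangentSubsheaf E X} {A : ProdVField E X}
    (hA : IsTimeDependentIn F A) :
    ∃ (N : ℕ) (a : ℕ → VField E X), (∀ i, a i ∈ F.sections ⊤) ∧ (∀ i ≥ N, a i = 0) ∧
      A = polyField a N := by
  obtain ⟨N, a, ha, h⟩ := hA
  refine ⟨N + 1, fun i => if i < N + 1 then a i else 0, fun i => ?_, fun i hi => if_neg (by lia),
    funext fun ⟨x, t⟩ => ?_⟩
  · beta_reduce
    split_ifs
    exacts [ha i, zero_mem _]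
  · refine (h x t).trans (congrArg (·, (0 : ℂ)) (Finset.sum_congr rfl fun i hi => ?_))
    beta_reduce
    rw [if_pos (Finset.mem_range.1 hi)]

lemma isTimeDependentIn_polyField {F : TangentSubsheaf E X} {a : ℕ → VField E X}
    (ha : ∀ i, a i ∈ F.sections ⊤) {N : ℕ} (haN : ∀ i ≥ N, a i = 0) :
    IsTimeDependentIn F (polyField a N) :=
  ⟨N, a, ha, fun x t => by rw [polyField_eq_of_le haN N.le_succ]; rfl⟩

end Construction

end JetExt

theorem proposition3p2
    {E : Type*} [NormedAddCommGroup E] [NormedSpace ℂ E] [FiniteDimensional ℂ E]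
    {X : Type*} [TopologicalSpace X] [T2Space X] [ChartedSpace E X] [IsManifold 𝓘(ℂ, E) ω X]
    (F : JetExt.TangentSubsheaf E X) (hF : F.LieClosed)
    (Y : Set X) (hY : JetExt.IsReducedSubspace E Y)
    (G : JetExt.AlongSubsheaf F Y) (hG : JetExt.IsObstructionSheaf G)
    (n : ℕ) (hn : 1 ≤ n)
    (A : JetExt.ProdVField E X) (hA : JetExt.IsAdmissible G n A)
    (Δ : JetExt.VField E X) (hΔF : Δ ∈ F.sections ⊤)
    (hΔG : JetExt.restrictTo Y Δ ∈ G.sections ⊤) :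
    ∃ B : JetExt.ProdVField E X,
      JetExt.IsAdmissible G (n + 1) B ∧
      (∀ y ∈ Y, JetExt.inducedJet n A y = JetExt.inducedJet n B y) ∧
      ∀ y ∈ Y, (JetExt.inducedJet (n + 1) B y).HasDifference
        (JetExt.inducedJet (n + 1) A y) (Δ y) := by
  open JetExt in
  have := FiniteDimensional.complete ℂ E
  have : IsManifold 𝓘(ℂ, E) 1 X := .of_le (n := ω) le_top
  obtain ⟨N, a, ha, haN, rfl⟩ := hA.1.exists_eq_polyField
  have hfac : ∀ m : ℕ, (m.factorial : ℂ) ≠ 0 := fun m => Nat.cast_ne_zero.2 m.factorial_ne_zero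
  set V : VField E X := (n.factorial : ℂ)⁻¹ • Δ with hV
  have hVF : V ∈ F.sections ⊤ := Submodule.smul_mem _ _ hΔF
  -- Intermediate field without `W`: the definition of `W` uses its iterated Lie derivative, which
  -- must not depend on `W`.
  set b₁ : ℕ → VField E X := fun i => a i + if i = n then V else 0 with hb₁
  have hb₁F : ∀ i, b₁ i ∈ F.sections ⊤ := fun i => by
    refine add_mem (ha i) ?_
    split_ifs
    exacts [hVF, zero_mem _]
  -- The last coefficient is chosen such that the last iterated Lie derivative vanishes.
  set W : VField E X := -((n + 1).factorial : ℂ)⁻¹ • (coeffLieD b₁)^[n + 1] b₁ 0 with hW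
  have hWF : W ∈ F.sections ⊤ :=
    Submodule.smul_mem _ _ (hF.iterate_coeffLieD_mem hb₁F (n + 1) 0)
  set b : ℕ → VField E X := fun i => b₁ i + if i = n + 1 then W else 0 with hb
  have hbF : ∀ i, b i ∈ F.sections ⊤ := fun i => by
    refine add_mem (hb₁F i) ?_
    split_ifs
    exacts [hWF, zero_mem _]
  -- The bound `N + n + 2` exceeds `n + 1` and is at least `N`, so both fields can be written over
  -- one range.
  have hbN : ∀ i ≥ N + n + 2, b i = 0 := fun i hi => by
    simp only [hb, hb₁]
    rw [haN i (by lia), if_neg (by lia), if_neg (by lia), add_zero, add_zero]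
  have haN' : ∀ i ≥ N + n + 2, a i = 0 := fun i hi => haN i (by lia)
  rw [polyField_eq_of_le haN (show N ≤ N + n + 2 by lia)] at hA ⊢
  have hab : ∀ i < n, a i = b i := fun i hi => by
    simp only [hb, hb₁]
    rw [if_neg (by lia), if_neg (by lia), add_zero, add_zero]
  have hbn : b n - a n = V := by
    simp only [hb, hb₁]
    rw [if_pos trivial, if_neg (by lia), add_zero, add_sub_cancel_left]
  have hb₁b : ∀ i < n + 1, b₁ i = b i := fun i hi => by
    simp only [hb]
    rw [if_neg (by lia), add_zero]
  have hbn₁ : b (n + 1) - b₁ (n + 1) = W := by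
    simp only [hb]
    rw [if_pos trivial, add_sub_cancel_left]
  have hderiv : ∀ (y : X) (f : X → ℂ), ContMDiffAt 𝓘(ℂ, E) 𝓘(ℂ, ℂ) ω f y → ∀ k ≤ n + 1,
      iteratedDeriv k (f ∘ integralCurve (polyField b (N + n + 2)) y) 0
        = iteratedDeriv k (f ∘ integralCurve (polyField a (N + n + 2)) y) 0
        + if k = n + 1 then (show ℂ from mfderiv 𝓘(ℂ, E) 𝓘(ℂ, ℂ) f y (Δ y)) else 0 := by
    intro y f hf k hk
    have hca := contDiffAt_chartRep_polyField (fun i => F.holomorphic ⊤ _ (ha i)) (N + n + 2) y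
    have hcb := contDiffAt_chartRep_polyField (fun i => F.holomorphic ⊤ _ (hbF i)) (N + n + 2) y
    refine iteratedDeriv_comp_isIntegralCurveGerm
      ((F.holomorphic ⊤ _ hΔF).contMDiffAt Filter.univ_mem)
      ((F.holomorphic ⊤ _ hWF).contMDiffAt Filter.univ_mem) hca (fun t => funext fun x => ?_)
      (isIntegralCurveGerm_integralCurve hca) (isIntegralCurveGerm_integralCurve hcb) hf hk
    change ∑ i ∈ Finset.range (N + n + 2), t ^ i • b i x
      = ∑ i ∈ Finset.range (N + n + 2), t ^ i • a i x + t ^ n • (V x + t • W x)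
    have hpt : ∀ i, t ^ i • b i x = t ^ i • a i x + (if i = n then t ^ n • V x else 0)
        + if i = n + 1 then t ^ (n + 1) • W x else 0 := fun i => by
      simp only [hb, hb₁, Pi.add_apply, smul_add]
      congr 1
      · congr 1
        split_ifs with h
        · rw [h]
        · exact smul_zero _
      · split_ifs with h
        · rw [h]
        · exact smul_zero _
    simp only [hpt, Finset.sum_add_distrib, Finset.sum_ite_eq', Finset.mem_range]
    rw [if_pos (by lia), if_pos (by lia), smul_add, smul_smul, pow_succ, add_assoc]
  refine ⟨polyField b (N + n + 2), ⟨isTimeDependentIn_polyField hbF hbN, fun m hm1 hm => ?_⟩,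
    fun y _ => inducedJet_eq_of_iteratedDeriv fun f hf k hk => ?_,
    fun y _ => hasDifference_inducedJet_of_iteratedDeriv (hderiv y)⟩
  · rw [hF.atTime_zero_iterate_lieD hbF hbN]
    rcases hm.lt_or_eq with hm | rfl
    · have hAm := hA.2 m hm1 (by lia)
      rw [hF.atTime_zero_iterate_lieD ha haN'] at hAm
      obtain ⟨h1, h2⟩ := iterate_coeffLieD_sub hab m (by lia)
      rcases (Nat.lt_succ_iff.1 hm).lt_or_eq with hmn | rfl
      -- For `m < n` the discrepancy still sits in degree `n - m > 0`, invisible at time zero.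
      · rwa [← h1 0 (by lia)]
      -- For `m = n` it has reached degree zero and equals `n! • V = Δ`.
      · rw [Nat.sub_self, Nat.descFactorial_self, hbn, hV, smul_inv_smul₀ (hfac _),
          sub_eq_iff_eq_add] at h2
        rw [h2]
        exact add_mem hΔG hAm
    -- For `m = n + 1` the comparison is with `b₁`: the contribution `(n + 1)! • W` cancels its last
    -- iterate, leaving zero on all of `X`.
    · have h2 := (iterate_coeffLieD_sub hb₁b (n + 1) le_rfl).2
      rw [Nat.sub_self, Nat.descFactorial_self, hbn₁, hW, neg_smul, smul_neg,
        smul_inv_smul₀ (hfac _), sub_eq_iff_eq_add, neg_add_cancel] at h2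
      rw [h2]
      exact zero_mem _
  · rw [hderiv y f hf k (by lia), if_neg (by lia), add_zero]
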